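/- Let $(T,\mathcal B)$ be a measurable space, $K\ge 1$, let $(T_{(i)},\rho_{(i)})$, $i=1,\dots,K$, be metric spaces with their Borel $\sigma$-algebras, and let $h_{(i)}:T\to T_{(i)}$ be surjective measurable maps. Put $$\mathcal F=\bigcup_{i=1}^K\{f\circ h_{(i)} : f:T_{(i)}\to\mathbb R \text{ is 1-Lipschitz w.r.t. } \rho_{(i)}\},\qquad \mathcal U(\mu,\nu)=\sup_{g\in\mathcal F}\Bigl|\int g\,d\mu-\int g\,d\nu\Bigr|$$ (by Kantorovich–Rubinstein duality, $\mathcal U(\mu,\nu)=\max_i W_1((h_{(i)})_\#\mu,(h_{(i)})_\#\nu)$). Let $N(T_{(i)},\rho_{(i)},x)\in\mathbb N\cup\{\infty\}$ be the least number of closed $\rho_{(i)}$-balls of radius $x$ with centres in $T_{(i)}$ that cover $T_{(i)}$, and for $t>0$ let $$\Lambda(t)=\max_{1\le i\le K}\bigl(\lceil\log_2 N(T_{(i)},\rho_{(i)},t)\rceil+1+\log K\bigr)^2\int_{t/2}^{\operatorname{diam}(T_{(i)})/2}N(T_{(i)},\rho_{(i)},x)\,dx\in[0,\infty],$$ where the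 integral is $0$ if $\operatorname{diam}(T_{(i)})\le t$. For a data set $D=(x_1,\dots,x_n)\in T^n$ let $\mu_D=\frac1n\sum_j\delta_{x_j}$. There is a universal constant $c>0$ such that in every such setting, for all $n\ge1$, $\varepsilon>0$ and $t>0$, there is a randomized algorithm $\mathcal A$ (a measurable function of the data set and of an independent random seed) that takes data sets $D\in T^n$ as input, depends on $D$ only through $\mu_D$, and returns a finitely supported probability measure $\mathcal A(D)$ on $T$, such that $\mathcal A$ is $\varepsilon$-differentially private, that is, $$\mathbb P(\mathcal A(D)\in S)\le e^{\varepsilon}\,\mathbb P(\mathcal A(D')\in S)$$ for all $D,D'\in T^n$ that differ in at most one entry and all measurable sets $S$ of probability measures, and such that for every $D\in T^n$ the utility loss $\mathcal U(\mu_D,\mathcal A(D))$ is a random variable with $$\mathbb E\,\mathcal U(\mu_D,\mathcal A(D))\le t+cK\,\Lambda(t)\qquad\text{and}\qquad \mathbb E\,\mathcal U(\mu_D,\mathcal A(D))\le \tau+\frac{cK}{n\varepsilon}\,\Lambda(t),$$ where $\tau=t$ if $K=1$ and $\tau=2t$ if $K\ge2$. -/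

import Mathlib

open MeasureTheory
open scoped ENNReal NNReal

/-- The class `F = ⋃ i, {f ∘ h i | f : X i → ℝ is 1-Lipschitz}` of functions on `T`. -/
def lipschitzQueries {T ι : Type*} {X : ι → Type*} [∀ i, MetricSpace (X i)]
    (h : ∀ i, T → X i) : Set (T → ℝ) :=
  {g | ∃ (i : ι) (f : X i → ℝ), LipschitzWith 1 f ∧ g = f ∘ h i}

/-- The utility loss over a function class `F`: the supremum over `g ∈ F` of `|∫ g dμ - ∫ g dν|`,
as an extended nonnegative real. -/
noncomputable def utilityLoss {T : Type*} [MeasurableSpace T] (F : Set (T → ℝ))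
    (μ ν : Measure T) : ℝ≥0∞ :=
  ⨆ g ∈ F, ENNReal.ofReal |(∫ x, g x ∂μ) - ∫ x, g x ∂ν|

/-- The empirical measure of a data set of size `n`. -/
noncomputable def empiricalMeasure {T : Type*} [MeasurableSpace T] {n : ℕ}
    (D : Fin n → T) : Measure T :=
  (n : ℝ≥0∞)⁻¹ • ∑ j, Measure.dirac (D j)

/-- A finite combination of Dirac measures. -/
def FinitelySupported {T : Type*} [MeasurableSpace T] (ν : Measure T) : Prop :=
  ∃ (s : Finset T) (w : T → ℝ≥0∞), ν = ∑ x ∈ s, w x • Measure.dirac x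

/-- A randomized algorithm taking data sets of size `n` in `T` to probability measures on `T`:
its output is a measurable function of the data set and of a random seed `ω`, which is drawn from
a probability space independently of the data. -/
structure RandomizedAlgorithm (n : ℕ) (T : Type*) [MeasurableSpace T] where
  Ω : Type
  [mΩ : MeasurableSpace Ω]
  P : Measure Ω
  [isProb : IsProbabilityMeasure P]
  run : (Fin n → T) → Ω → ProbabilityMeasure T
  measurable_run : Measurable (Function.uncurry run)

attribute [instance] RandomizedAlgorithm.mΩ RandomizedAlgorithm.isProb

/-- `ε`-differential privacy: for data sets `D`, `D'` that agree outside a single entry, the output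
laws satisfy `ℙ(A(D) ∈ S) ≤ e^ε ℙ(A(D') ∈ S)` for all measurable `S`. -/
def RandomizedAlgorithm.IsDP {n : ℕ} {T : Type*} [MeasurableSpace T]
    (A : RandomizedAlgorithm n T) (ε : ℝ) : Prop :=
  ∀ D D' : Fin n → T, (∃ j, ∀ k, k ≠ j → D k = D' k) →
    ∀ S : Set (ProbabilityMeasure T), MeasurableSet S →
      A.P {ω | A.run D ω ∈ S} ≤ ENNReal.ofReal (Real.exp ε) * A.P {ω | A.run D' ω ∈ S}

/-- `N(X, ρ, x)`: the least number of closed balls of radius `x` with centres in `X` that cover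
`X` (`⊤` if there is no finite cover). -/
noncomputable def covNum (X : Type*) [MetricSpace X] (x : ℝ) : ℕ∞ :=
  Metric.coveringNumber x.toNNReal (Set.univ : Set X)

/-- `⌈log₂ m⌉` for an extended natural number `m`, with `⌈log₂ ∞⌉ = ∞`. -/
noncomputable def ceilLogTwo : ℕ∞ → ℝ≥0∞
  | ⊤ => ⊤
  | (m : ℕ) => (Nat.clog 2 m : ℝ≥0∞)

/-- `∫_{t/2}^{diam(X)/2} N(X, ρ, x) dx`, in `[0, ∞]`; it is `0` if `diam X ≤ t`. -/
noncomputable def coveringIntegral (X : Type*) [MetricSpace X] (t : ℝ) : ℝ≥0∞ :=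
  ∫⁻ x in {x : ℝ | t / 2 ≤ x ∧ ENNReal.ofReal x ≤ Metric.ediam (Set.univ : Set X) / 2},
    (covNum X x : ℝ≥0∞)

/-- `max_i (⌈log₂ N(X i, t)⌉ + 1 + log K)² ∫_{t/2}^{diam(X i)/2} N(X i, x) dx`. -/
noncomputable def stackedComplexity {K : ℕ} (X : Fin K → Type*) [∀ i, MetricSpace (X i)]
    (t : ℝ) : ℝ≥0∞ :=
  ⨆ i, (ceilLogTwo (covNum (X i) t) + 1 + ENNReal.ofReal (Real.log K)) ^ 2 *
    coveringIntegral (X i) t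

/-!
The algorithm releases noisy counts and returns the data set that fits them best.

*Chaining.* On a space `X` take covers by `2 ^ k` points, `k = 0, …, m`, the last one at scale `t`,
and let every point of the `(k+1)`-st cover have a parent in the `k`-th one. A 1-Lipschitz function
on the finest cover is a constant plus the sum of its increments from parent to child, each bounded
by the radius `r k` of the coarser cover. Its integral is therefore a combination of the counts of
the data at the nodes of this tree, with coefficients bounded by weights that do not depend on the
function and have sum at most `∑ k, 2 ^ (k + 1) * r k` (`HasChaining`). With `r k` comparable to the
radius at which the covering number drops to `2 ^ k`, a layer-cake argument bounds this sum by the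
covering integral (`exists_chaining`). There are only `⌈log₂ N(t)⌉` levels, and one data point enters
one count per level, so integer Laplace noise of scale proportional to `K (⌈log₂ N(t)⌉ + 1) / ε` on
the counts of each of the `K` spaces makes their release `ε`-private
(`laplaceNoise_preimage_add_le`).

*Fitting.* The output is the empirical measure of a data set, with points in a finite set of
representatives, whose counts are closest to the noisy ones in the maximum over the spaces of the
weighted `ℓ¹` distances. Since the discretized data compete, the loss is at most twice the size of
the noise (`blockNorm_bestFit_sub_le`) plus the discretization errors, and exponential moments bound
the expected maximum over the `K` spaces at the price of a factor `log K + 2`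
(`lintegral_norm_pi_le`). The data are displaced by `t`. If `K = 1` the representatives are preimages
of the centres of the cover, so that nothing else is lost; for `K ≥ 2` they only share their
discretization with some data point, which costs another `t`.

*Degenerate ranges.* The loss never exceeds the largest diameter, which is at most `t + 2 Λ(t)`; this
is the first bound for every such algorithm. The covering integral does not control the chaining sum
when the diameter is close to `t`. For `K ≥ 2` the spaces of diameter at most `2 t` are simply ignored.
For `K = 1` and diameter `d < 4 t / 3`, either one level at scale `d / 2 ≤ 2 t / 3` is accurate enough,
or the noise level is so high that a constant output satisfies the bound.
-/

/-! ### Two-sided geometric noise -/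

theorem hasSum_geometric_natAbs {q : ℝ} (hq : 0 ≤ q) (hq1 : q < 1) :
    HasSum (fun k : ℤ => q ^ k.natAbs) ((1 + q) / (1 - q)) := by
  have h1 : HasSum (fun k : ℕ => q ^ (k : ℤ).natAbs) (1 - q)⁻¹ := by
    simpa using hasSum_geometric_of_lt_one hq hq1
  have h2 : HasSum (fun k : ℕ => q ^ (-((k : ℤ) + 1)).natAbs) (q * (1 - q)⁻¹) := by
    have hk : ∀ k : ℕ, q ^ (-((k : ℤ) + 1)).natAbs = q * q ^ k := fun k => by
      rw [show (-((k : ℤ) + 1)).natAbs = k + 1 by omega, pow_succ']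
    simpa only [hk] using (hasSum_geometric_of_lt_one hq hq1).mul_left q
  convert HasSum.of_nat_of_neg_add_one (f := fun k : ℤ => q ^ k.natAbs) h1 h2 using 1
  field_simp

/-- The probability that a two-sided geometric variable with ratio `q` equals `k`. -/
noncomputable def geometricWeight (q : ℝ) (k : ℤ) : ℝ := (1 - q) / (1 + q) * q ^ k.natAbs

theorem geometricWeight_nonneg {q : ℝ} (hq : 0 ≤ q) (hq1 : q < 1) (k : ℤ) :
    0 ≤ geometricWeight q k :=
  mul_nonneg (div_nonneg (by linarith) (by linarith)) (pow_nonneg hq _)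

theorem hasSum_geometricWeight {q : ℝ} (hq : 0 ≤ q) (hq1 : q < 1) :
    HasSum (geometricWeight q) 1 := by
  have h1 : 1 - q ≠ 0 := by linarith
  have h2 : 1 + q ≠ 0 := by linarith
  have h3 : (1 - q) / (1 + q) * ((1 + q) / (1 - q)) = 1 := by field_simp
  rw [← h3]
  exact (hasSum_geometric_natAbs hq hq1).mul_left ((1 - q) / (1 + q))

theorem exp_neg_one_div_lt_one {b : ℝ} (hb : 0 < b) : Real.exp (-(1 / b)) < 1 := by
  rw [Real.exp_lt_one_iff]
  have : 0 < 1 / b := by positivity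
  linarith

/-- The two-sided geometric law (discrete Laplace law) of scale `b > 0` on `ℤ`, which gives the
integer `k` a mass proportional to `exp (-|k| / b)`. -/
noncomputable def discreteLaplace (b : ℝ) : Measure ℤ :=
  Measure.count.withDensity fun k => ENNReal.ofReal (geometricWeight (Real.exp (-(1 / b))) k)

theorem discreteLaplace_singleton (b : ℝ) (k : ℤ) :
    discreteLaplace b {k} = ENNReal.ofReal (geometricWeight (Real.exp (-(1 / b))) k) := by
  simp [discreteLaplace, withDensity_apply]

theorem lintegral_discreteLaplace (b : ℝ) (f : ℤ → ℝ≥0∞) :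
    ∫⁻ k, f k ∂discreteLaplace b =
      ∑' k, f k * ENNReal.ofReal (geometricWeight (Real.exp (-(1 / b))) k) := by
  simp [lintegral_countable', discreteLaplace_singleton]

theorem isProbabilityMeasure_discreteLaplace {b : ℝ} (hb : 0 < b) :
    IsProbabilityMeasure (discreteLaplace b) := by
  have hq1 := exp_neg_one_div_lt_one hb
  have hs := hasSum_geometricWeight (Real.exp_pos _).le hq1
  constructor
  rw [← lintegral_one, lintegral_discreteLaplace]
  simp only [one_mul]
  rw [← ENNReal.ofReal_tsum_of_nonneg (geometricWeight_nonneg (Real.exp_pos _).le hq1) hs.summable,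
    hs.tsum_eq, ENNReal.ofReal_one]

/-- Shifting the argument costs a factor `exp (|k - l| / b)`: the source of privacy. -/
theorem discreteLaplace_singleton_le {b : ℝ} (hb : 0 < b) (k l : ℤ) :
    discreteLaplace b {k} ≤
      ENNReal.ofReal (Real.exp (|(k : ℝ) - l| / b)) * discreteLaplace b {l} := by
  have hq1 := exp_neg_one_div_lt_one hb
  rw [discreteLaplace_singleton, discreteLaplace_singleton, ← ENNReal.ofReal_mul (Real.exp_pos _).le]
  apply ENNReal.ofReal_le_ofReal
  unfold geometricWeight
  have h0 : 0 ≤ (1 - Real.exp (-(1 / b))) / (1 + Real.exp (-(1 / b))) :=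
    div_nonneg (by linarith) (by positivity)
  rw [mul_left_comm]
  refine mul_le_mul_of_nonneg_left ?_ h0
  rw [← Real.exp_nat_mul, ← Real.exp_nat_mul, ← Real.exp_add, Real.exp_le_exp,
    Nat.cast_natAbs, Nat.cast_natAbs, Int.cast_abs, Int.cast_abs]
  have := abs_sub_abs_le_abs_sub (l : ℝ) k
  rw [abs_sub_comm] at this
  have h3 : 0 ≤ (|(k : ℝ) - l| - (|(l : ℝ)| - |(k : ℝ)|)) / b := div_nonneg (by linarith) hb.le
  have h4 : (|(k : ℝ) - l| - (|(l : ℝ)| - |(k : ℝ)|)) / b =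
    (|(k : ℝ) - l| / b + |(l : ℝ)| * -(1 / b)) - |(k : ℝ)| * -(1 / b) := by ring
  linarith

/-- The absolute value of a discrete Laplace variable has exponential moments at half its scale. -/
theorem lintegral_exp_discreteLaplace_le {b : ℝ} (hb : 0 < b) :
    ∫⁻ k, ENNReal.ofReal (Real.exp (|(k : ℝ)| / (2 * b))) ∂discreteLaplace b ≤ 2 := by
  have hq1 := exp_neg_one_div_lt_one hb
  have hp1 := exp_neg_one_div_lt_one (b := 2 * b) (by positivity)
  set p := Real.exp (-(1 / (2 * b))) with hp
  have hp0 : 0 < p := Real.exp_pos _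
  have hqp : Real.exp (-(1 / b)) = p * p := by
    rw [hp, ← Real.exp_add]; congr 1; field_simp; norm_num
  have hs := (hasSum_geometric_natAbs hp0.le hp1).mul_left ((1 - p * p) / (1 + p * p))
  rw [lintegral_discreteLaplace]
  have hterm : ∀ k : ℤ, ENNReal.ofReal (Real.exp (|(k : ℝ)| / (2 * b))) *
      ENNReal.ofReal (geometricWeight (Real.exp (-(1 / b))) k) =
      ENNReal.ofReal ((1 - p * p) / (1 + p * p) * p ^ k.natAbs) := by
    intro k
    have he : Real.exp (|(k : ℝ)| / (2 * b)) * p ^ k.natAbs = 1 := by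
      rw [hp, ← Real.exp_nat_mul, ← Real.exp_add, Real.exp_eq_one_iff, Nat.cast_natAbs,
        Int.cast_abs]
      ring
    rw [← ENNReal.ofReal_mul (Real.exp_pos _).le, geometricWeight, hqp, mul_pow]
    congr 1
    linear_combination (1 - p * p) / (1 + p * p) * p ^ k.natAbs * he
  have hnn : 0 ≤ (1 - p * p) / (1 + p * p) := div_nonneg (by nlinarith) (by positivity)
  simp_rw [hterm]
  rw [← ENNReal.ofReal_tsum_of_nonneg (fun k => mul_nonneg hnn (pow_nonneg hp0.le _)) hs.summable,
    hs.tsum_eq]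
  rw [show (2 : ℝ≥0∞) = ENNReal.ofReal 2 by simp]
  apply ENNReal.ofReal_le_ofReal
  have h1 : 1 - p ≠ 0 := by linarith
  have : (1 - p * p) / (1 + p * p) * ((1 + p) / (1 - p)) = (1 + p) ^ 2 / (1 + p * p) := by
    field_simp; ring
  rw [this, div_le_iff₀ (by positivity)]
  nlinarith [sq_nonneg (1 - p)]

/-- Independent discrete Laplace noise on the coordinates in `A`, of scale `b a` on the
coordinate `a`. -/
noncomputable def laplaceNoise {A : Type*} [Fintype A] (b : A → ℝ) : Measure (A → ℤ) :=
  Measure.pi fun a => discreteLaplace (b a)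

section LaplaceNoise

variable {A : Type*} [Fintype A] {b : A → ℝ}

theorem isProbabilityMeasure_laplaceNoise (hb : ∀ a, 0 < b a) :
    IsProbabilityMeasure (laplaceNoise b) := by
  have := fun a => isProbabilityMeasure_discreteLaplace (hb a)
  unfold laplaceNoise
  infer_instance

theorem lintegral_eval_laplaceNoise (hb : ∀ a, 0 < b a) (a : A) (f : ℤ → ℝ≥0∞) :
    ∫⁻ ω, f (ω a) ∂laplaceNoise b = ∫⁻ k, f k ∂discreteLaplace (b a) := by
  have := fun a => isProbabilityMeasure_discreteLaplace (hb a)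
  rw [← (measurePreserving_eval (fun a => discreteLaplace (b a)) a).map_eq,
    lintegral_map (measurable_of_countable f) (measurable_pi_apply a)]
  rfl

theorem laplaceNoise_singleton_le (hb : ∀ a, 0 < b a) (x y : A → ℤ) :
    laplaceNoise b {x} ≤
      ENNReal.ofReal (Real.exp (∑ a, |(x a : ℝ) - y a| / b a)) * laplaceNoise b {y} := by
  have := fun a => isProbabilityMeasure_discreteLaplace (hb a)
  rw [laplaceNoise, Measure.pi_singleton, Measure.pi_singleton, Real.exp_sum,
    ENNReal.ofReal_prod_of_nonneg fun a _ => (Real.exp_pos _).le, ← Finset.prod_mul_distrib]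
  exact Finset.prod_le_prod' fun a _ => discreteLaplace_singleton_le (hb a) _ _

/-- The additive-noise mechanism: adding Laplace noise to integer vectors `c`, `c'` that are close
in the weighted `ℓ¹` distance gives close laws. -/
theorem laplaceNoise_preimage_add_le (hb : ∀ a, 0 < b a) {ε : ℝ} {c c' : A → ℤ}
    (hc : ∑ a, |(c a : ℝ) - c' a| / b a ≤ ε) (B : Set (A → ℤ)) :
    laplaceNoise b {ω | c + ω ∈ B} ≤
      ENNReal.ofReal (Real.exp ε) * laplaceNoise b {ω | c' + ω ∈ B} := by
  have key : ∀ c : A → ℤ, laplaceNoise b {ω | c + ω ∈ B} =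
      ∑' y, B.indicator 1 y * laplaceNoise b {y - c} := by
    intro c
    rw [← lintegral_indicator_one (Set.to_countable _).measurableSet, lintegral_countable',
      ← (Equiv.subRight c).tsum_eq]
    refine tsum_congr fun y => ?_
    simp only [Equiv.subRight_apply]
    congr 1
    have hy : c + (y - c) = y := by abel
    by_cases h : y ∈ B
    · rw [Set.indicator_of_mem h, Set.indicator_of_mem (by rwa [Set.mem_ofPred_eq, hy])]; rfl
    · rw [Set.indicator_of_notMem h, Set.indicator_of_notMem (by rwa [Set.mem_ofPred_eq, hy])]
  rw [key c, key c', ← ENNReal.tsum_mul_left]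
  refine ENNReal.tsum_le_tsum fun y => ?_
  rw [mul_left_comm]
  gcongr
  refine (laplaceNoise_singleton_le hb (y - c) (y - c')).trans ?_
  gcongr
  refine le_trans (Finset.sum_le_sum fun a _ => le_of_eq ?_) hc
  rw [abs_sub_comm (c a : ℝ)]
  congr 2
  simp

/-- Jensen's inequality for `exp`, with total weight at most one. -/
theorem exp_sum_mul_le {B : Type*} (s : Finset B) (p u : B → ℝ) (hp : ∀ a ∈ s, 0 ≤ p a)
    (hp1 : ∑ a ∈ s, p a ≤ 1) :
    Real.exp (∑ a ∈ s, p a * u a) ≤ ∑ a ∈ s, p a * Real.exp (u a) + (1 - ∑ a ∈ s, p a) := by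
  set v := ∑ a ∈ s, p a * u a with hv
  have hv0 := Real.exp_pos v
  have h1 : ∀ x : ℝ, Real.exp v * (1 + (x - v)) ≤ Real.exp x := by
    intro x
    have := Real.add_one_le_exp (x - v)
    calc _ ≤ Real.exp v * Real.exp (x - v) := by gcongr; linarith
      _ = Real.exp x := by rw [← Real.exp_add]; congr 1; ring
  have h2 : ∑ a ∈ s, p a * (Real.exp v * (1 + (u a - v))) ≤ ∑ a ∈ s, p a * Real.exp (u a) :=
    Finset.sum_le_sum fun a ha => mul_le_mul_of_nonneg_left (h1 _) (hp a ha)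
  have h3 : ∑ a ∈ s, p a * (Real.exp v * (1 + (u a - v))) =
      Real.exp v * ((∑ a ∈ s, p a) * (1 - v) + v) := by
    rw [hv, Finset.sum_mul, ← Finset.sum_add_distrib, Finset.mul_sum]
    refine Finset.sum_congr rfl fun a _ => ?_
    ring
  have h4 := mul_le_mul_of_nonneg_left (h1 0) (sub_nonneg.2 hp1)
  rw [Real.exp_zero] at h4
  rw [h3] at h2
  linarith

/-- A weighted `ℓ¹` norm of Laplace noise has an exponential moment; independence plays no role. -/
theorem lintegral_exp_weighted_laplaceNoise_le (hb : ∀ a, 0 < b a) {B : Type*} [Fintype B] (e : B → A)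
    {w : B → ℝ}
    (hw : ∀ a, 0 ≤ w a) {M : ℝ} (hM : 0 < M)
    (hbw : ∑ a, b (e a) * w a ≤ M) :
    ∫⁻ ω, ENNReal.ofReal (Real.exp ((∑ a, w a * |(ω (e a) : ℝ)|) / (2 * M))) ∂laplaceNoise b
      ≤ 2 := by
  have := isProbabilityMeasure_laplaceNoise hb
  set p : B → ℝ := fun a => b (e a) * w a / M with hp
  have hp0 : ∀ a, 0 ≤ p a := fun a => div_nonneg (mul_nonneg (hb (e a)).le (hw a)) hM.le
  have hp1 : ∑ a, p a ≤ 1 := by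
    rw [hp, ← Finset.sum_div, div_le_one hM]; exact hbw
  have hpt : ∀ ω : A → ℤ,
      ENNReal.ofReal (Real.exp ((∑ a, w a * |(ω (e a) : ℝ)|) / (2 * M))) ≤
      ∑ a, ENNReal.ofReal (p a) * ENNReal.ofReal (Real.exp (|(ω (e a) : ℝ)| / (2 * b (e a)))) +
        ENNReal.ofReal (1 - ∑ a, p a) := by
    intro ω
    have h := exp_sum_mul_le Finset.univ p (fun a => |(ω (e a) : ℝ)| / (2 * b (e a))) (fun a _ => hp0 a) hp1
    have he : ∑ a, p a * (|(ω (e a) : ℝ)| / (2 * b (e a))) =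
        (∑ a, w a * |(ω (e a) : ℝ)|) / (2 * M) := by
      rw [Finset.sum_div]
      refine Finset.sum_congr rfl fun a _ => ?_
      have := (hb (e a)).ne'
      simp only [hp]
      field_simp
    rw [he] at h
    refine (ENNReal.ofReal_le_ofReal h).trans (ENNReal.ofReal_add_le.trans ?_)
    gcongr
    rw [ENNReal.ofReal_sum_of_nonneg fun a _ => mul_nonneg (hp0 a) (Real.exp_pos _).le]
    refine (Finset.sum_congr rfl fun a _ => ?_).le
    rw [ENNReal.ofReal_mul (hp0 a)]
  refine (lintegral_mono hpt).trans ?_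
  rw [lintegral_add_right _ measurable_const, lintegral_finsetSum _ fun a _ => measurable_of_countable _]
  simp only [lintegral_const, measure_univ, mul_one]
  have hle : ∀ a ∈ Finset.univ, ∫⁻ ω, ENNReal.ofReal (p a) *
      ENNReal.ofReal (Real.exp (|((ω (e a) : ℤ) : ℝ)| / (2 * b (e a)))) ∂laplaceNoise b ≤
      ENNReal.ofReal (p a * 2) := by
    intro a _
    rw [lintegral_const_mul _ (measurable_of_countable _), lintegral_eval_laplaceNoise hb (e a)
      (fun k => ENNReal.ofReal (Real.exp (|(k : ℝ)| / (2 * b (e a))))), ENNReal.ofReal_mul (hp0 a)]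
    gcongr
    simpa using lintegral_exp_discreteLaplace_le (hb (e a))
  refine (add_le_add_left (Finset.sum_le_sum hle) _).trans ?_
  rw [← ENNReal.ofReal_sum_of_nonneg fun a _ => mul_nonneg (hp0 a) zero_le_two,
    ← ENNReal.ofReal_add (Finset.sum_nonneg fun a _ => mul_nonneg (hp0 a) zero_le_two)
      (sub_nonneg.2 hp1), ← Finset.sum_mul]
  rw [show (2 : ℝ≥0∞) = ENNReal.ofReal 2 by simp]
  apply ENNReal.ofReal_le_ofReal
  linarith

end LaplaceNoise

/-- A maximum of `K` nonnegative variables with bounded exponential moments has expectation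
`O(log K)`. The maximum is written as a norm on `Fin K → ℝ`. -/
theorem lintegral_norm_pi_le {Ω : Type*} [MeasurableSpace Ω] {P : Measure Ω}
    [IsProbabilityMeasure P] {K : ℕ} (hK : 0 < K) {Y : Ω → Fin K → ℝ} (hY : Measurable Y)
    (hY0 : ∀ ω i, 0 ≤ Y ω i) {M : ℝ} (hM : 0 < M)
    (hexp : ∀ i, ∫⁻ ω, ENNReal.ofReal (Real.exp (Y ω i / (2 * M))) ∂P ≤ 2) :
    ∫⁻ ω, ENNReal.ofReal ‖Y ω‖ ∂P ≤ ENNReal.ofReal (2 * M * (Real.log K + 2)) := by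
  have hK' : (0 : ℝ) < K := by exact_mod_cast hK
  have hlog : 0 ≤ Real.log K := Real.log_natCast_nonneg K
  have hpt : ∀ ω, ENNReal.ofReal ‖Y ω‖ ≤ ENNReal.ofReal (2 * M) * (ENNReal.ofReal (Real.log K) +
      ENNReal.ofReal (1 / K) * ∑ i, ENNReal.ofReal (Real.exp (Y ω i / (2 * M)))) := by
    intro ω
    rw [← ENNReal.ofReal_sum_of_nonneg fun i _ => (Real.exp_pos _).le,
      ← ENNReal.ofReal_mul (by positivity), ← ENNReal.ofReal_add hlog (by positivity),
      ← ENNReal.ofReal_mul (by positivity)]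
    apply ENNReal.ofReal_le_ofReal
    rw [pi_norm_le_iff_of_nonneg (by positivity)]
    intro i
    rw [Real.norm_of_nonneg (hY0 ω i)]
    -- the inequality `u ≤ exp u` at `u = Y i / (2 M) - log K`
    have h1 := Real.add_one_le_exp (Y ω i / (2 * M) - Real.log K)
    rw [Real.exp_sub, Real.exp_log hK'] at h1
    have h2 : Real.exp (Y ω i / (2 * M)) ≤ ∑ i, Real.exp (Y ω i / (2 * M)) :=
      Finset.single_le_sum (f := fun i => Real.exp (Y ω i / (2 * M)))
        (fun i _ => (Real.exp_pos _).le) (Finset.mem_univ i)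
    have h3 : Real.exp (Y ω i / (2 * M)) / K ≤ 1 / K * ∑ i, Real.exp (Y ω i / (2 * M)) := by
      rw [one_div, inv_mul_eq_div]; gcongr
    have h4 : Y ω i / (2 * M) ≤ Real.log K + 1 / K * ∑ i, Real.exp (Y ω i / (2 * M)) := by
      linarith
    rwa [div_le_iff₀' (by positivity)] at h4
  refine (lintegral_mono hpt).trans ?_
  have hm : ∀ i, Measurable fun ω => ENNReal.ofReal (Real.exp (Y ω i / (2 * M))) := by
    intro i; fun_prop
  rw [lintegral_const_mul _ (by fun_prop), lintegral_add_left measurable_const,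
    lintegral_const_mul _ (by fun_prop), lintegral_finsetSum _ fun i _ => hm i,
    lintegral_const, measure_univ, mul_one,
    ENNReal.ofReal_mul (p := 2 * M) (by positivity), ENNReal.ofReal_add hlog zero_le_two]
  gcongr
  calc _ ≤ ENNReal.ofReal (1 / K) * ∑ _i : Fin K, 2 := by
        gcongr with i; exact hexp i
    _ = ENNReal.ofReal 2 := by
        rw [Finset.sum_const, Finset.card_univ, Fintype.card_fin, nsmul_eq_mul,
          show ((K : ℝ≥0∞) * 2) = ENNReal.ofReal (K * 2) by
            rw [ENNReal.ofReal_mul hK'.le]; simp,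
          ← ENNReal.ofReal_mul (by positivity)]
        congr 1; field_simp
    _ ≤ _ := le_rfl

/-! ### Empirical measures and the utility loss -/

section Empirical

variable {T : Type*} [MeasurableSpace T] {n : ℕ}

theorem isProbabilityMeasure_empiricalMeasure (hn : 0 < n) (D : Fin n → T) :
    IsProbabilityMeasure (empiricalMeasure D) := by
  constructor
  simp only [empiricalMeasure, Measure.smul_apply, Measure.coe_finsetSum, Finset.sum_apply,
    measure_univ, Finset.sum_const, Finset.card_univ, Fintype.card_fin, nsmul_eq_mul, mul_one,
    smul_eq_mul]
  exact ENNReal.inv_mul_cancel (by exact_mod_cast hn.ne') (ENNReal.natCast_ne_top n)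

theorem finitelySupported_empiricalMeasure (D : Fin n → T) :
    FinitelySupported (empiricalMeasure D) := by
  classical
  refine ⟨Finset.univ.image D, fun x => (n : ℝ≥0∞)⁻¹ * (Finset.univ.filter (D · = x)).card, ?_⟩
  rw [empiricalMeasure, ← Finset.sum_fiberwise_of_maps_to (g := D) (t := Finset.univ.image D)
    (fun j _ => Finset.mem_image_of_mem D (Finset.mem_univ j)), Finset.smul_sum]
  refine Finset.sum_congr rfl fun x _ => ?_
  rw [Finset.sum_congr rfl (g := fun _ => Measure.dirac x) fun j hj => by
    rw [(Finset.mem_filter.1 hj).2], Finset.sum_const, mul_smul, Nat.cast_smul_eq_nsmul]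

theorem integral_empiricalMeasure (D : Fin n → T) {g : T → ℝ} (hg : Measurable g) :
    ∫ x, g x ∂empiricalMeasure D = (n : ℝ)⁻¹ * ∑ j, g (D j) := by
  rw [empiricalMeasure, integral_smul_measure, integral_finsetSum_measure]
  · simp [integral_dirac' _ _ hg.stronglyMeasurable]
  · intro j _
    exact integrable_dirac' hg.stronglyMeasurable (by simp)

/-- The empirical measure of `D` as a probability measure. -/
noncomputable def empiricalProbability (hn : 0 < n) (D : Fin n → T) : ProbabilityMeasure T :=
  ⟨empiricalMeasure D, isProbabilityMeasure_empiricalMeasure hn D⟩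

/-- The measurability of the maps `h i` makes the integrals of Lipschitz queries finite averages, even
if the points of `T` are not measurable sets. -/
theorem utilityLoss_empiricalMeasure_le {ι : Type*} {X : ι → Type*} [∀ i, MetricSpace (X i)]
    [∀ i, MeasurableSpace (X i)] [∀ i, BorelSpace (X i)] {h : ∀ i, T → X i}
    (hmeas : ∀ i, Measurable (h i)) (D E : Fin n → T) {B : ℝ≥0∞}
    (hB : ∀ i, ∀ f : X i → ℝ, LipschitzWith 1 f →
      ENNReal.ofReal ((n : ℝ)⁻¹ * |∑ j, (f (h i (D j)) - f (h i (E j)))|) ≤ B) :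
    utilityLoss (lipschitzQueries h) (empiricalMeasure D) (empiricalMeasure E) ≤ B := by
  refine iSup₂_le ?_
  rintro g ⟨i, f, hf, rfl⟩
  have hm : Measurable (f ∘ h i) := hf.continuous.measurable.comp (hmeas i)
  rw [integral_empiricalMeasure D hm, integral_empiricalMeasure E hm, ← mul_sub,
    ← Finset.sum_sub_distrib, abs_mul, abs_of_nonneg (by positivity)]
  exact hB i f hf

/-- A bound for a single pair of points bounds the difference of two empirical averages. -/
theorem inv_mul_abs_sum_le {n : ℕ} (hn : 0 < n) {u : Fin n → ℝ} {B : ℝ} (hu : ∀ j, |u j| ≤ B) :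
    (n : ℝ)⁻¹ * |∑ j, u j| ≤ B := by
  have hn' : (0 : ℝ) < n := by exact_mod_cast hn
  rw [inv_mul_le_iff₀ hn']
  calc _ ≤ ∑ j, |u j| := Finset.abs_sum_le_sum_abs _ _
    _ ≤ ∑ _j : Fin n, B := Finset.sum_le_sum fun j _ => hu j
    _ = n * B := by simp

/-- The loss between two data sets never exceeds the largest diameter. -/
theorem ofReal_inv_mul_abs_sum_le_ediam {Y : Type*} [MetricSpace Y] (hn : 0 < n)
    (x y : Fin n → Y) {f : Y → ℝ} (hf : LipschitzWith 1 f) :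
    ENNReal.ofReal ((n : ℝ)⁻¹ * |∑ j, (f (x j) - f (y j))|) ≤
      Metric.ediam (Set.univ : Set Y) := by
  rcases eq_or_ne (Metric.ediam (Set.univ : Set Y)) ⊤ with htop | htop
  · simp [htop]
  rw [← ENNReal.ofReal_toReal htop]
  refine ENNReal.ofReal_le_ofReal (inv_mul_abs_sum_le hn fun j => ?_)
  rw [← Real.dist_eq]
  refine (hf.dist_le_mul _ _).trans ?_
  rw [NNReal.coe_one, one_mul, dist_edist]
  exact ENNReal.toReal_mono htop (Metric.edist_le_ediam_of_mem (Set.mem_univ _) (Set.mem_univ _))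

theorem utilityLoss_empiricalMeasure_le_iSup_ediam {ι : Type*} {X : ι → Type*}
    [∀ i, MetricSpace (X i)] [∀ i, MeasurableSpace (X i)] [∀ i, BorelSpace (X i)]
    {h : ∀ i, T → X i} (hmeas : ∀ i, Measurable (h i)) (hn : 0 < n) (D E : Fin n → T) :
    utilityLoss (lipschitzQueries h) (empiricalMeasure D) (empiricalMeasure E) ≤
      ⨆ i, Metric.ediam (Set.univ : Set (X i)) :=
  utilityLoss_empiricalMeasure_le hmeas D E fun i _ hf =>
    (ofReal_inv_mul_abs_sum_le_ediam hn (fun j => h i (D j)) (fun j => h i (E j)) hf).trans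
      (le_iSup (fun i => Metric.ediam (Set.univ : Set (X i))) i)

end Empirical

/-! ### Noisy counts and the best-fitting data set -/

section Counts

variable {T S A : Type*} {n : ℕ}

/-- The vector of counts `∑ j, χ a (E j)` of a data set `E`, for queries `χ a`, `a ∈ A`. -/
def queryCounts (χ : A → S → ℤ) (E : Fin n → S) : A → ℤ := fun a => ∑ j, χ a (E j)

/-- The counts are integrals of measurable functions, hence determined by the empirical measure. -/
theorem queryCounts_comp_congr [MeasurableSpace T] [MeasurableSpace S] [DiscreteMeasurableSpace S]
    (hn : 0 < n) {φ : T → S} (hφ : Measurable φ) (χ : A → S → ℤ) {D D' : Fin n → T}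
    (hD : empiricalMeasure D = empiricalMeasure D') :
    queryCounts χ (φ ∘ D) = queryCounts χ (φ ∘ D') := by
  funext a
  have hm : Measurable fun x : T => ((χ a (φ x) : ℤ) : ℝ) :=
    (Measurable.of_discrete (f := fun s => ((χ a s : ℤ) : ℝ))).comp hφ
  have h := integral_empiricalMeasure D hm
  rw [hD, integral_empiricalMeasure D' hm] at h
  have hn' : (n : ℝ)⁻¹ ≠ 0 := by
    have : (0 : ℝ) < n := by exact_mod_cast hn
    positivity
  have := mul_left_cancel₀ hn' h
  simp only [queryCounts, Function.comp]
  exact_mod_cast this.symm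

theorem queryCounts_sub_of_agree (χ : A → S → ℤ) {E E' : Fin n → S} {j : Fin n}
    (hE : ∀ k, k ≠ j → E k = E' k) (a : A) :
    queryCounts χ E a - queryCounts χ E' a = χ a (E j) - χ a (E' j) := by
  rw [queryCounts, queryCounts, ← Finset.sum_sub_distrib]
  exact Finset.sum_eq_single j (fun k _ hk => by rw [hE k hk, sub_self]) (by simp)

theorem measurable_queryCounts_add [Countable A] [MeasurableSpace T] [MeasurableSpace S]
    [DiscreteMeasurableSpace S] {φ : T → S} (hφ : Measurable φ) (χ : A → S → ℤ) :
    Measurable fun p : (Fin n → T) × (A → ℤ) => queryCounts χ (φ ∘ p.1) + p.2 := by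
  refine measurable_pi_lambda _ fun a => ?_
  have h2 : Measurable fun p : (Fin n → T) × (A → ℤ) => p.2 a :=
    (measurable_pi_apply a).comp measurable_snd
  refine Measurable.add (Finset.measurable_fun_sum _ fun j _ => ?_) h2
  exact (Measurable.of_discrete (f := χ a)).comp
    (hφ.comp ((measurable_pi_apply j).comp measurable_fst))

end Counts

section Mechanism

variable {T S : Type*} {n K : ℕ} {A : Fin K → Type} [∀ i, Fintype (A i)]

/-- The worst weighted `ℓ¹` size, over the `K` blocks of coordinates, of the vector `v`. -/
noncomputable def blockNorm (w : ∀ i, A i → ℝ) (v : (Σ i, A i) → ℤ) : ℝ :=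
  ‖fun i => ∑ a, w i a * |(v ⟨i, a⟩ : ℝ)|‖

theorem sum_le_blockNorm (w : ∀ i, A i → ℝ) (v : (Σ i, A i) → ℤ) (i : Fin K) :
    ∑ a, w i a * |(v ⟨i, a⟩ : ℝ)| ≤ blockNorm w v :=
  (le_abs_self _).trans (norm_le_pi_norm (fun i => ∑ a, w i a * |(v ⟨i, a⟩ : ℝ)|) i)

theorem blockNorm_neg (w : ∀ i, A i → ℝ) (v : (Σ i, A i) → ℤ) :
    blockNorm w (-v) = blockNorm w v := by
  simp [blockNorm]

theorem blockNorm_add_le {w : ∀ i, A i → ℝ} (hw : ∀ i a, 0 ≤ w i a) (u v : (Σ i, A i) → ℤ) :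
    blockNorm w (u + v) ≤ blockNorm w u + blockNorm w v := by
  refine (pi_norm_le_iff_of_nonneg (add_nonneg (norm_nonneg _) (norm_nonneg _))).2 fun i => ?_
  rw [Real.norm_of_nonneg (Finset.sum_nonneg fun a _ => mul_nonneg (hw i a) (abs_nonneg _))]
  refine le_trans ?_ (add_le_add (sum_le_blockNorm w u i) (sum_le_blockNorm w v i))
  rw [← Finset.sum_add_distrib]
  refine Finset.sum_le_sum fun a _ => ?_
  rw [← mul_add]
  refine mul_le_mul_of_nonneg_left ?_ (hw i a)
  rw [Pi.add_apply, Int.cast_add]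
  exact abs_add_le _ _

/-- A data set in the finite set `S` whose counts are closest to the vector `y`. -/
noncomputable def bestFit [Finite S] [Nonempty S] (n : ℕ) (χ : (Σ i, A i) → S → ℤ)
    (w : ∀ i, A i → ℝ) (y : (Σ i, A i) → ℤ) : Fin n → S :=
  (Finite.exists_min fun E : Fin n → S => blockNorm w (queryCounts χ E - y)).choose

theorem bestFit_le [Finite S] [Nonempty S] (χ : (Σ i, A i) → S → ℤ) (w : ∀ i, A i → ℝ)
    (y : (Σ i, A i) → ℤ) (E : Fin n → S) :
    blockNorm w (queryCounts χ (bestFit n χ w y) - y) ≤ blockNorm w (queryCounts χ E - y) :=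
  (Finite.exists_min fun E : Fin n → S => blockNorm w (queryCounts χ E - y)).choose_spec E

/-- Fitting to counts perturbed by `ω` loses at most twice the size of `ω`. -/
theorem blockNorm_bestFit_sub_le [Finite S] [Nonempty S] (χ : (Σ i, A i) → S → ℤ)
    {w : ∀ i, A i → ℝ} (hw : ∀ i a, 0 ≤ w i a) (E : Fin n → S) (ω : (Σ i, A i) → ℤ) :
    blockNorm w (queryCounts χ E - queryCounts χ (bestFit n χ w (queryCounts χ E + ω))) ≤
      2 * blockNorm w ω := by
  set y := queryCounts χ E + ω with hy
  have h1 := bestFit_le χ w y E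
  have h2 : queryCounts χ E - y = -ω := by rw [hy]; abel
  have h3 : queryCounts χ E - queryCounts χ (bestFit n χ w y) =
      -ω + -(queryCounts χ (bestFit n χ w y) - y) := by rw [hy]; abel
  rw [h3]
  refine (blockNorm_add_le hw _ _).trans ?_
  rw [blockNorm_neg, blockNorm_neg]
  rw [h2, blockNorm_neg] at h1
  linarith

variable [MeasurableSpace T] [MeasurableSpace S] [DiscreteMeasurableSpace S]

/-- Release the counts of the data set with Laplace noise of scale `b i` on the `i`-th block, and
return the empirical measure of the data set of representatives that fits the noisy counts best. -/
noncomputable def bestFitAlgorithm [Finite S] [Nonempty S] (hn : 0 < n) {φ : T → S}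
    (hφ : Measurable φ) (rep : S → T) (χ : (Σ i, A i) → S → ℤ) (w : ∀ i, A i → ℝ) {b : Fin K → ℝ}
    (hb : ∀ i, 0 < b i) : RandomizedAlgorithm n T where
  Ω := (Σ i, A i) → ℤ
  P := laplaceNoise fun a => b a.1
  isProb := isProbabilityMeasure_laplaceNoise fun a => hb a.1
  run D ω := empiricalProbability hn (rep ∘ bestFit n χ w (queryCounts χ (φ ∘ D) + ω))
  measurable_run := (measurable_of_countable fun y : (Σ i, A i) → ℤ =>
    empiricalProbability hn (rep ∘ bestFit n χ w y)).comp (measurable_queryCounts_add hφ χ)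

/-- If `ε` bounds the total change of the queries between two points, each measured in units of its
noise scale, then the counts of neighbouring data sets are close enough for `ε`-privacy. -/
theorem bestFitAlgorithm_isDP [Finite S] [Nonempty S] (hn : 0 < n) {φ : T → S}
    (hφ : Measurable φ) (rep : S → T) (χ : (Σ i, A i) → S → ℤ) (w : ∀ i, A i → ℝ) {b : Fin K → ℝ}
    (hb : ∀ i, 0 < b i) {ε : ℝ}
    (hχ : ∀ s s', ∑ a, |(χ a s : ℝ) - χ a s'| / b a.1 ≤ ε) :
    (bestFitAlgorithm hn hφ rep χ w hb).IsDP ε := by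
  rintro D D' ⟨j, hj⟩ V _
  refine laplaceNoise_preimage_add_le (fun a : Σ i, A i => hb a.1) (ε := ε)
    (c := queryCounts χ (φ ∘ D)) (c' := queryCounts χ (φ ∘ D')) ?_
    {y | empiricalProbability hn (rep ∘ bestFit n χ w y) ∈ V}
  refine (Finset.sum_le_sum fun a _ => le_of_eq ?_).trans (hχ (φ (D j)) (φ (D' j)))
  have := queryCounts_sub_of_agree χ (E := φ ∘ D) (E' := φ ∘ D') (j := j)
    (fun k hk => by simp [hj k hk]) a
  congr 2
  exact_mod_cast this

theorem lintegral_blockNorm_le (hK : 0 < K) {w : ∀ i, A i → ℝ} (hw : ∀ i a, 0 ≤ w i a)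
    {b : Fin K → ℝ} (hb : ∀ i, 0 < b i) {M : ℝ} (hM : 0 < M) (hbw : ∀ i, b i * ∑ a, w i a ≤ M) :
    ∫⁻ ω, ENNReal.ofReal (blockNorm w ω) ∂laplaceNoise (fun a : Σ i, A i => b a.1) ≤
      ENNReal.ofReal (2 * M * (Real.log K + 2)) := by
  have := isProbabilityMeasure_laplaceNoise fun a : Σ i, A i => hb a.1
  refine lintegral_norm_pi_le hK (measurable_of_countable _) (fun ω i =>
    Finset.sum_nonneg fun a _ => mul_nonneg (hw i a) (abs_nonneg _)) hM fun i => ?_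
  refine lintegral_exp_weighted_laplaceNoise_le (fun a : Σ i, A i => hb a.1)
    (fun a : A i => ⟨i, a⟩) (hw i) hM ?_
  simpa only [Finset.mul_sum] using hbw i

end Mechanism

/-! ### Chaining decompositions of Lipschitz functions -/

/-- The points `ℓ s`, `s ∈ S`, of `X` admit a chaining decomposition with sensitivity `2 * L` and
total weight `W`: there are finitely many integer queries `χ a` on `S` such that each 1-Lipschitz
function on the points `ℓ s` is a constant plus a combination of the `χ a`, with coefficients
bounded by weights `w a` that do not depend on the function and have sum at most `W`. -/
def HasChaining {X S : Type*} [MetricSpace X] (ℓ : S → X) (L : ℕ) (W : ℝ) : Prop :=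
  ∃ (A : Type) (_ : Fintype A) (χ : A → S → ℤ) (w : A → ℝ),
    (∀ a, 0 ≤ w a) ∧ ∑ a, w a ≤ W ∧
    (∀ s s', ∑ a, |(χ a s : ℝ) - χ a s'| ≤ 2 * L) ∧
    ∀ f : X → ℝ, LipschitzWith 1 f →
      ∃ (c : ℝ) (g : A → ℝ), (∀ a, |g a| ≤ w a) ∧ ∀ s, f (ℓ s) = c + ∑ a, χ a s * g a

namespace HasChaining

variable {X : Type*} [MetricSpace X]

theorem of_subsingleton {S : Type*} [Subsingleton S] [Nonempty S] (ℓ : S → X) :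
    HasChaining ℓ 0 0 := by
  obtain ⟨s₀⟩ := ‹Nonempty S›
  refine ⟨Empty, inferInstance, fun a => a.elim, fun a => a.elim, fun a => a.elim, by simp,
    by simp, fun f _ => ⟨f (ℓ s₀), fun a => a.elim, fun a => a.elim, fun s => ?_⟩⟩
  simp [Subsingleton.elim s s₀]

theorem mono {S : Type*} {ℓ : S → X} {L : ℕ} {W W' : ℝ} (h : HasChaining ℓ L W)
    (hW : W ≤ W') : HasChaining ℓ L W' := by
  obtain ⟨A, _, χ, w, h0, h1, h2⟩ := h
  exact ⟨A, _, χ, w, h0, h1.trans hW, h2⟩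

theorem comp {S S' : Type*} {ℓ : S → X} {L : ℕ} {W : ℝ} (h : HasChaining ℓ L W) (p : S' → S) :
    HasChaining (fun s => ℓ (p s)) L W := by
  obtain ⟨A, _, χ, w, h0, h1, h2, h3⟩ := h
  refine ⟨A, _, fun a s => χ a (p s), w, h0, h1, fun s s' => h2 _ _, fun f hf => ?_⟩
  obtain ⟨c, g, hg, hs⟩ := h3 f hf
  exact ⟨c, g, hg, fun s => hs _⟩

/-- Refinement by one level: every new point `ℓ' s` has a parent `ℓ (p s)` within distance `r`,
and the increments `f (ℓ' s) - f (ℓ (p s))` are queried through the indicators of the points. -/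
theorem refine {S S' : Type} [Fintype S'] {ℓ : S → X} {L : ℕ} {W : ℝ} (h : HasChaining ℓ L W)
    (ℓ' : S' → X) (p : S' → S) {r : ℝ} (hr : 0 ≤ r) (hp : ∀ s, dist (ℓ' s) (ℓ (p s)) ≤ r) :
    HasChaining ℓ' (L + 1) (W + Fintype.card S' * r) := by
  classical
  obtain ⟨A, _, χ, w, hw0, hwW, hL, hf⟩ := h
  refine ⟨A ⊕ S', inferInstance,
    Sum.elim (fun a s => χ a (p s)) (fun a s => if a = s then 1 else 0),
    Sum.elim w fun _ => r, ?_, ?_, ?_, ?_⟩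
  · rintro (a | a)
    · exact hw0 a
    · exact hr
  · simpa using hwW
  · intro s s'
    have h1 : ∑ a : S', |(((if a = s then 1 else 0 : ℤ)) : ℝ) - ((if a = s' then 1 else 0 : ℤ))| ≤
        ∑ a : S', (((if a = s then 1 else 0 : ℝ)) + (if a = s' then 1 else 0)) := by
      refine Finset.sum_le_sum fun a _ => ?_
      split_ifs <;> norm_num
    rw [Finset.sum_add_distrib] at h1
    simp only [Finset.sum_ite_eq', Finset.mem_univ, if_true] at h1
    simp only [Fintype.sum_sum_type, Sum.elim_inl, Sum.elim_inr]
    push_cast at h1 ⊢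
    linarith [hL (p s) (p s')]
  · intro f hfl
    obtain ⟨c, g, hg, hs⟩ := hf f hfl
    refine ⟨c, Sum.elim g fun s => f (ℓ' s) - f (ℓ (p s)), ?_, fun s => ?_⟩
    · rintro (a | s)
      · exact hg a
      · rw [Sum.elim_inr, Sum.elim_inr, ← Real.dist_eq]
        refine (hfl.dist_le_mul _ _).trans ?_
        simpa using hp s
    · simp only [Fintype.sum_sum_type, Sum.elim_inl, Sum.elim_inr]
      rw [← add_assoc, ← hs (p s)]
      simp

/-- A single level of points, at mutual distance at most `r`. -/
theorem of_dist_le {S : Type} [Fintype S] [Nonempty S] (ℓ : S → X) {r : ℝ}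
    (hr : ∀ s s', dist (ℓ s) (ℓ s') ≤ r) : HasChaining ℓ 1 (Fintype.card S * r) := by
  obtain ⟨s₀⟩ := ‹Nonempty S›
  have := (of_subsingleton fun _ : Unit => ℓ s₀).refine ℓ (fun _ => ())
    (dist_nonneg.trans (hr s₀ s₀)) fun s => hr s s₀
  simpa using this

/-- The chaining along covers by `2 ^ k` points, `k = 0, …, m`, of radii `r k`. -/
theorem of_covers {m : ℕ} (c : ∀ k, Fin (2 ^ k) → X) {r : ℕ → ℝ} (hr : ∀ k < m, 0 ≤ r k)
    (hc : ∀ k < m, ∀ x, ∃ j, dist x (c k j) ≤ r k) :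
    HasChaining (c m) m (∑ k ∈ Finset.range m, 2 ^ (k + 1) * r k) := by
  induction m with
  | zero =>
    have : Subsingleton (Fin (2 ^ 0)) := by rw [pow_zero]; infer_instance
    simpa using of_subsingleton (c 0)
  | succ m ih =>
    have ih' := ih (fun k hk => hr k (by omega)) (fun k hk => hc k (by omega))
    choose p hp using hc m (Nat.lt_succ_self m)
    have := ih'.refine (c (m + 1)) (fun j => p (c (m + 1) j)) (hr m (Nat.lt_succ_self m))
      fun s => hp _
    rw [Finset.sum_range_succ]
    simpa using this

end HasChaining

/-! ### Covering numbers -/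

section Covering

variable {X : Type*} [MetricSpace X]

theorem covNum_anti {x y : ℝ} (hxy : x ≤ y) : covNum X y ≤ covNum X x :=
  Metric.coveringNumber_anti (Real.toNNReal_le_toNNReal hxy)

theorem one_le_covNum [Nonempty X] (x : ℝ) : 1 ≤ covNum X x := by
  rw [Order.one_le_iff_pos]
  exact Metric.coveringNumber_pos_iff.2 Set.univ_nonempty

theorem covNum_le_one {x : ℝ} (hx : Metric.ediam (Set.univ : Set X) ≤ ENNReal.ofReal x) :
    covNum X x ≤ 1 :=
  Metric.coveringNumber_le_one_of_ediam_le hx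

theorem exists_cover_of_covNum_le [Nonempty X] {x : ℝ} (hx : 0 ≤ x) {N : ℕ}
    (hN : covNum X x ≤ N) : ∃ c : Fin N → X, ∀ y, ∃ j, dist y (c j) ≤ x := by
  have htop : covNum X x ≠ ⊤ := ne_top_of_le_ne_top (ENat.natCast_ne_top N) hN
  obtain ⟨C, -, hfin, hcov, hcard⟩ := Metric.exists_set_encard_eq_coveringNumber htop
  have hN0 : 0 < N := by
    have := (one_le_covNum (X := X) x).trans hN
    exact_mod_cast this
  have hC : hfin.toFinset.card ≤ N := by
    have h : C.encard ≤ N := hcard.trans_le hN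
    rw [hfin.encard_eq_coe_toFinset_card] at h
    exact_mod_cast h
  have hCne : C.Nonempty := hcov.nonempty Set.univ_nonempty
  obtain ⟨z₀, hz₀⟩ := hCne
  let e := hfin.toFinset.equivFin
  refine ⟨fun j => if h : (j : ℕ) < hfin.toFinset.card then (e.symm ⟨j, h⟩ : X) else z₀,
    fun y => ?_⟩
  obtain ⟨z, hz, hyz⟩ := hcov (Set.mem_univ y)
  have hz' : z ∈ hfin.toFinset := hfin.mem_toFinset.2 hz
  refine ⟨⟨e ⟨z, hz'⟩, (e ⟨z, hz'⟩).2.trans_le hC⟩, ?_⟩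
  simp only [Fin.is_lt, dif_pos, Fin.eta, Equiv.symm_apply_apply]
  have h : edist y z ≤ ENNReal.ofReal x := hyz
  rwa [edist_dist, ENNReal.ofReal_le_ofReal_iff hx] at h

/-- A finite cover can be followed measurably. -/
theorem exists_measurable_index [MeasurableSpace X] [BorelSpace X] {N : ℕ} {c : Fin N → X}
    {x : ℝ} (hc : ∀ y, ∃ j, dist y (c j) ≤ x) :
    ∃ φ : X → Fin N, Measurable φ ∧ ∀ y, dist y (c (φ y)) ≤ x := by
  classical
  refine ⟨fun y => Fin.find (fun j => dist y (c j) ≤ x) (hc y), ?_, fun y => Fin.find_spec (hc y)⟩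
  refine measurable_to_countable' fun j => ?_
  have : (fun y => Fin.find (fun j => dist y (c j) ≤ x) (hc y)) ⁻¹' {j} =
      {y | dist y (c j) ≤ x} ∩ ⋂ i : Fin N, ⋂ _ : i < j, {y | dist y (c i) ≤ x}ᶜ := by
    ext y
    simp [Fin.find_eq_iff]
  rw [this]
  have hcl : ∀ i, MeasurableSet {y | dist y (c i) ≤ x} := fun i =>
    (isClosed_le (continuous_id.dist continuous_const) continuous_const).measurableSet
  exact (hcl j).inter (MeasurableSet.iInter fun i => MeasurableSet.iInter fun _ => (hcl i).compl)

/-- The covering integral over a space of finite diameter `d`. -/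
theorem coveringIntegral_eq {d : ℝ} (hd : Metric.ediam (Set.univ : Set X) = ENNReal.ofReal d)
    {t : ℝ} (ht : 0 < t) :
    coveringIntegral X t = ∫⁻ x in Set.Icc (t / 2) (d / 2), (covNum X x : ℝ≥0∞) := by
  have hset : {x : ℝ | t / 2 ≤ x ∧ ENNReal.ofReal x ≤ Metric.ediam (Set.univ : Set X) / 2} =
      Set.Icc (t / 2) (d / 2) := by
    ext x
    refine and_congr_right fun hx => ?_
    have hx0 : ¬ x ≤ 0 := by linarith
    rw [hd, show (2 : ℝ≥0∞) = ENNReal.ofReal 2 by simp, ← ENNReal.ofReal_div_of_pos two_pos,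
      ENNReal.ofReal_le_ofReal_iff', or_iff_left hx0]
  rw [coveringIntegral, hset]

/-- The integrand is at least its value at the upper end of the range of integration. -/
theorem covNum_mul_le_coveringIntegral {d : ℝ}
    (hd : Metric.ediam (Set.univ : Set X) = ENNReal.ofReal d) {t : ℝ} (ht : 0 < t) :
    (covNum X (d / 2) : ℝ≥0∞) * ENNReal.ofReal ((d - t) / 2) ≤ coveringIntegral X t := by
  rw [coveringIntegral_eq hd ht, show (d - t) / 2 = d / 2 - t / 2 by ring, ← Real.volume_Icc,
    ← setLIntegral_const]
  refine setLIntegral_mono' measurableSet_Icc fun x hx => ?_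
  exact ENat.toENNReal_le.2 (covNum_anti hx.2)

/-- The covering integral is at least the length `(diam X - t) / 2` of its range. -/
theorem ediam_le_add_coveringIntegral [Nonempty X] {t : ℝ} (ht : 0 < t) :
    Metric.ediam (Set.univ : Set X) ≤ ENNReal.ofReal t + 2 * coveringIntegral X t := by
  have hone : ∀ x : ℝ, (1 : ℝ≥0∞) ≤ covNum X x := fun x => by
    exact_mod_cast ENat.toENNReal_le.2 (one_le_covNum (X := X) x)
  rcases eq_or_ne (Metric.ediam (Set.univ : Set X)) ⊤ with htop | htop
  · have h : coveringIntegral X t = ⊤ := by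
      rw [coveringIntegral, htop, ENNReal.top_div_of_ne_top ENNReal.ofNat_ne_top, eq_top_iff]
      calc ⊤ = ∫⁻ _ in Set.Ici (t / 2), (1 : ℝ≥0∞) := by simp
        _ ≤ ∫⁻ x in Set.Ici (t / 2), (covNum X x : ℝ≥0∞) := lintegral_mono fun x => hone x
        _ ≤ _ := lintegral_mono_set (show Set.Ici (t / 2) ⊆
              {x : ℝ | t / 2 ≤ x ∧ ENNReal.ofReal x ≤ ⊤} from fun x hx => ⟨hx, le_top⟩)
    simp [h]
  · have hd := (ENNReal.ofReal_toReal htop).symm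
    set d := (Metric.ediam (Set.univ : Set X)).toReal
    have h := covNum_mul_le_coveringIntegral hd ht
    calc Metric.ediam (Set.univ : Set X) = ENNReal.ofReal (t + 2 * ((d - t) / 2)) := by
          rw [hd]; congr 1; ring
      _ ≤ ENNReal.ofReal t + 2 * (1 * ENNReal.ofReal ((d - t) / 2)) := by
          refine ENNReal.ofReal_add_le.trans ?_
          rw [ENNReal.ofReal_mul zero_le_two, one_mul]; simp
      _ ≤ _ := by
          gcongr
          exact (mul_le_mul_left (hone _) _).trans h

/-- The radius `ρ` at which the covering number drops to `2 ^ k`. A cover by `2 ^ k` balls of radius `ρ`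
itself need not exist, but one of radius at most `2 * ρ` does. -/
theorem exists_threshold [Nonempty X] {d : ℝ}
    (hd : Metric.ediam (Set.univ : Set X) = ENNReal.ofReal d) {t : ℝ} (ht : 0 < t) {k : ℕ}
    (hk : ((2 ^ k : ℕ) : ℕ∞) < covNum X t) :
    ∃ ρ, t ≤ ρ ∧ ρ ≤ d ∧ (∀ x < ρ, ((2 ^ k : ℕ) : ℕ∞) < covNum X x) ∧
      ∃ r, 0 ≤ r ∧ r ≤ 2 * ρ ∧ covNum X r ≤ ((2 ^ k : ℕ) : ℕ∞) := by
  set R : Set ℝ := {x | covNum X x ≤ ((2 ^ k : ℕ) : ℕ∞)} with hR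
  have hdR : d ∈ R := by
    refine (covNum_le_one hd.le).trans ?_
    exact_mod_cast Nat.one_le_two_pow
  have hlow : ∀ x ∈ R, t ≤ x := fun x hx => by
    by_contra! hlt
    exact absurd (hk.trans_le ((covNum_anti hlt.le).trans hx)) (lt_irrefl _)
  have hbdd : BddBelow R := ⟨t, hlow⟩
  have htρ : t ≤ sInf R := le_csInf ⟨d, hdR⟩ hlow
  obtain ⟨r, hr, hrρ⟩ := exists_lt_of_csInf_lt ⟨d, hdR⟩ (show sInf R < 2 * sInf R by linarith)
  refine ⟨sInf R, htρ, csInf_le hbdd hdR, fun x hx => ?_, r, ht.le.trans (hlow r hr), hrρ.le, hr⟩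
  by_contra! hle
  exact absurd (csInf_le hbdd hle) (not_le.2 hx)

theorem sum_two_pow_le_two_mul {F : Finset ℕ} {M : ℕ} (hF : ∀ k ∈ F, 2 ^ k < M) :
    ∑ k ∈ F, 2 ^ k ≤ 2 * M := by
  rcases F.eq_empty_or_nonempty with rfl | hne
  · simp
  · have h1 := Nat.geomSum_lt (m := 2) (n := F.max' hne + 1) (s := F) le_rfl
      fun k hk => Nat.lt_succ_of_le (F.le_max' k hk)
    have h2 := hF _ (F.max'_mem hne)
    rw [pow_succ] at h1
    omega

/-- The layer-cake comparison of the chaining sum with the covering integral: where the covering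
number is `N`, only the scales with `2 ^ k < N` are active, and their sum is at most `2 N`. -/
theorem sum_two_pow_mul_le_coveringIntegral {d : ℝ}
    (hd : Metric.ediam (Set.univ : Set X) = ENNReal.ofReal d) {t : ℝ} (ht : 0 < t) (m : ℕ)
    {ρ : ℕ → ℝ} (hρ : ∀ k < m, ∀ x < ρ k, ((2 ^ k : ℕ) : ℕ∞) < covNum X x) :
    ∑ k ∈ Finset.range m, ENNReal.ofReal (2 ^ k * (min (ρ k) (d / 2) - t / 2)) ≤
      2 * coveringIntegral X t := by
  classical
  have hterm : ∀ k ∈ Finset.range m, ENNReal.ofReal (2 ^ k * (min (ρ k) (d / 2) - t / 2)) =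
      ∫⁻ x in Set.Icc (t / 2) (d / 2),
        (Set.Ico (t / 2) (min (ρ k) (d / 2))).indicator (fun _ => ((2 ^ k : ℕ) : ℝ≥0∞)) x := by
    intro k _
    rw [lintegral_indicator measurableSet_Ico, Measure.restrict_restrict measurableSet_Ico,
      Set.inter_eq_left.2 (show Set.Ico (t / 2) (min (ρ k) (d / 2)) ⊆ Set.Icc (t / 2) (d / 2) from
        fun x hx => ⟨hx.1, hx.2.le.trans (min_le_right _ _)⟩),
      setLIntegral_const, Real.volume_Ico, ENNReal.ofReal_mul (by positivity)]
    congr 1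
    rw [← ENNReal.ofReal_natCast]
    push_cast
    rfl
  rw [Finset.sum_congr rfl hterm, ← lintegral_finsetSum _ fun k _ =>
    measurable_const.indicator measurableSet_Ico, coveringIntegral_eq hd ht,
    ← lintegral_const_mul' _ _ ENNReal.ofNat_ne_top]
  refine lintegral_mono fun x => ?_
  rcases eq_or_ne (covNum X x) ⊤ with htop | htop
  · simp [htop]
  obtain ⟨M, hM⟩ := ENat.ne_top_iff_exists.1 htop
  have hF := sum_two_pow_le_two_mul (F := (Finset.range m).filter fun k => x < ρ k) (M := M)
    fun k hk => by
      have := hρ k (Finset.mem_range.1 (Finset.mem_filter.1 hk).1) x (Finset.mem_filter.1 hk).2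
      rw [← hM] at this
      exact_mod_cast this
  calc _ ≤ ∑ k ∈ Finset.range m, if x < ρ k then ((2 ^ k : ℕ) : ℝ≥0∞) else 0 := by
        refine Finset.sum_le_sum fun k _ => ?_
        by_cases hx : x ∈ Set.Ico (t / 2) (min (ρ k) (d / 2))
        · rw [Set.indicator_of_mem hx, if_pos (hx.2.trans_le (min_le_left _ _))]
        · rw [Set.indicator_of_notMem hx]; exact zero_le
    _ = ((∑ k ∈ (Finset.range m).filter fun k => x < ρ k, 2 ^ k : ℕ) : ℝ≥0∞) := by
        rw [← Finset.sum_filter, Nat.cast_sum]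
    _ ≤ ((2 * M : ℕ) : ℝ≥0∞) := by exact_mod_cast hF
    _ = 2 * (covNum X x : ℝ≥0∞) := by rw [← hM]; simp

/-- Chaining down to an optimal `t`-cover, at the scales at which the covering number doubles. -/
theorem exists_chaining [Nonempty X] {d : ℝ}
    (hd : Metric.ediam (Set.univ : Set X) = ENNReal.ofReal d) {t : ℝ} (ht : 0 < t)
    (htd : 4 * t / 3 ≤ d) {N : ℕ} (hN : covNum X t = N) {J : ℝ} (hJ : 0 ≤ J)
    (hXJ : coveringIntegral X t = ENNReal.ofReal J) :
    ∃ c : Fin (2 ^ Nat.clog 2 N) → X, (∀ y, ∃ j, dist y (c j) ≤ t) ∧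
      HasChaining c (Nat.clog 2 N) (64 * J) := by
  set m := Nat.clog 2 N with hm
  have hlt : ∀ k < m, ((2 ^ k : ℕ) : ℕ∞) < covNum X t := fun k hk => by
    rw [hN]
    exact_mod_cast (Nat.lt_clog_iff_pow_lt one_lt_two).1 hk
  have hex : ∀ k, ∃ ρ r : ℝ, ∃ c : Fin (2 ^ k) → X, k < m →
      t ≤ ρ ∧ ρ ≤ d ∧ (∀ x < ρ, ((2 ^ k : ℕ) : ℕ∞) < covNum X x) ∧ 0 ≤ r ∧ r ≤ 2 * ρ ∧
        ∀ y, ∃ j, dist y (c j) ≤ r := by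
    intro k
    by_cases hk : k < m
    · obtain ⟨ρ, h1, h2, h3, r, h4, h5, h6⟩ := exists_threshold hd ht (hlt k hk)
      obtain ⟨c, hc⟩ := exists_cover_of_covNum_le h4 h6
      exact ⟨ρ, r, c, fun _ => ⟨h1, h2, h3, h4, h5, hc⟩⟩
    · exact ⟨0, 0, fun _ => Classical.arbitrary X, fun h => absurd h hk⟩
  choose ρ r c hall using hex
  obtain ⟨cm, hcm⟩ := exists_cover_of_covNum_le (X := X) (x := t) ht.le (N := 2 ^ m) (by
    rw [hN]
    exact_mod_cast Nat.le_pow_clog one_lt_two N)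
  refine ⟨cm, hcm, ?_⟩
  have hcov := HasChaining.of_covers (m := m) (Function.update c m cm) (r := r)
    (fun k hk => (hall k hk).2.2.2.1) fun k hk => by
      rw [Function.update_of_ne hk.ne]
      exact (hall k hk).2.2.2.2.2
  rw [Function.update_self] at hcov
  refine hcov.mono ?_
  have hlayer := sum_two_pow_mul_le_coveringIntegral hd ht m fun k hk => (hall k hk).2.2.1
  -- Integrating only from `t / 2` to `d / 2` loses a constant factor, as `t ≤ ρ k ≤ d` and
  -- `4 * t / 3 ≤ d`.
  have hmin : ∀ k ∈ Finset.range m, ρ k / 8 ≤ min (ρ k) (d / 2) - t / 2 := by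
    intro k hk
    obtain ⟨h1, h2, -⟩ := hall k (Finset.mem_range.1 hk)
    rcases min_choice (ρ k) (d / 2) with h | h <;> rw [h] <;> linarith
  have hρ0 : ∀ k ∈ Finset.range m, 0 ≤ ρ k := fun k hk =>
    ht.le.trans (hall k (Finset.mem_range.1 hk)).1
  rw [← ENNReal.ofReal_sum_of_nonneg fun k hk => mul_nonneg (by positivity)
      (le_trans (by linarith [hρ0 k hk]) (hmin k hk)), hXJ,
    show (2 : ℝ≥0∞) = ENNReal.ofReal 2 by simp, ← ENNReal.ofReal_mul zero_le_two,
    ENNReal.ofReal_le_ofReal_iff (by positivity)] at hlayer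
  calc ∑ k ∈ Finset.range m, 2 ^ (k + 1) * r k
      ≤ ∑ k ∈ Finset.range m, 32 * (2 ^ k * (min (ρ k) (d / 2) - t / 2)) := by
        refine Finset.sum_le_sum fun k hk => ?_
        have h1 := (hall k (Finset.mem_range.1 hk)).2.2.2.2.1
        have h2 := hmin k hk
        have h3 : (0 : ℝ) ≤ 2 ^ k := by positivity
        rw [pow_succ]
        nlinarith
    _ ≤ 64 * J := by rw [← Finset.mul_sum]; linarith

end Covering

/-! ### Private algorithms from chaining decompositions -/

/-- The algorithm `𝒜` is `ε`-private, depends on the data only through their empirical measure, has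
finitely supported outputs, and its expected loss is at most `B` and at most the largest diameter of
the spaces `X i`. -/
def IsAccurate {T : Type*} [MeasurableSpace T] {K n : ℕ} {X : Fin K → Type*}
    [∀ i, MetricSpace (X i)] (h : ∀ i, T → X i) (ε : ℝ) (𝒜 : RandomizedAlgorithm n T)
    (B : ℝ≥0∞) : Prop :=
  𝒜.IsDP ε ∧
  (∀ D ω, FinitelySupported (𝒜.run D ω : Measure T)) ∧
  (∀ D D', empiricalMeasure D = empiricalMeasure D' → 𝒜.run D = 𝒜.run D') ∧
  ∀ D : Fin n → T,
    Measurable (fun ω => utilityLoss (lipschitzQueries h) (empiricalMeasure D) (𝒜.run D ω)) ∧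
    ∫⁻ ω, utilityLoss (lipschitzQueries h) (empiricalMeasure D) (𝒜.run D ω) ∂𝒜.P ≤
      ⨆ i, Metric.ediam (Set.univ : Set (X i)) ∧
    ∫⁻ ω, utilityLoss (lipschitzQueries h) (empiricalMeasure D) (𝒜.run D ω) ∂𝒜.P ≤ B

section Algorithms

variable {T : Type*} [MeasurableSpace T] {K n : ℕ} {X : Fin K → Type*} [∀ i, MetricSpace (X i)]
  {h : ∀ i, T → X i} {ε : ℝ}

theorem IsAccurate.mono {𝒜 : RandomizedAlgorithm n T} {B B' : ℝ≥0∞} (hA : IsAccurate h ε 𝒜 B)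
    (hB : B ≤ B') : IsAccurate h ε 𝒜 B' :=
  ⟨hA.1, hA.2.1, hA.2.2.1, fun D => ⟨(hA.2.2.2 D).1, (hA.2.2.2 D).2.1,
    (hA.2.2.2 D).2.2.trans hB⟩⟩

variable [∀ i, MeasurableSpace (X i)] [∀ i, BorelSpace (X i)]

/-- An algorithm that ignores the data. -/
theorem exists_isAccurate_iSup_ediam (hmeas : ∀ i, Measurable (h i)) (hn : 0 < n) (hε : 0 < ε) :
    ∃ 𝒜 : RandomizedAlgorithm n T,
      IsAccurate h ε 𝒜 (⨆ i, Metric.ediam (Set.univ : Set (X i))) := by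
  rcases isEmpty_or_nonempty T with hT | ⟨⟨x₀⟩⟩
  · have hD : IsEmpty (Fin n → T) := ⟨fun D => hT.elim (D ⟨0, hn⟩)⟩
    exact ⟨{ Ω := Unit, P := Measure.dirac (), run := fun D => hD.elim D,
             measurable_run := measurable_of_empty _ },
      fun D => hD.elim D, fun D => hD.elim D, fun D => hD.elim D, fun D => hD.elim D⟩
  · refine ⟨{ Ω := Unit, P := Measure.dirac (),
              run := fun _ _ => empiricalProbability hn fun _ => x₀,
              measurable_run := measurable_const }, ?_, ?_, fun _ _ _ => rfl, fun D => ?_⟩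
    · intro D D' _ V _
      refine le_mul_of_one_le_left' ?_
      rw [ENNReal.one_le_ofReal]
      exact Real.one_le_exp hε.le
    · exact fun _ _ => finitelySupported_empiricalMeasure _
    · have hle := utilityLoss_empiricalMeasure_le_iSup_ediam hmeas hn D fun _ => x₀
      have hint : ∫⁻ _ : Unit, utilityLoss (lipschitzQueries h) (empiricalMeasure D)
          (empiricalMeasure fun _ : Fin n => x₀) ∂Measure.dirac () ≤
          ⨆ i, Metric.ediam (Set.univ : Set (X i)) := by simpa using hle
      exact ⟨measurable_of_countable (α := Unit) _, hint, hint⟩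

/-- A chaining decomposition turns closeness of counts into closeness of integrals. -/
theorem abs_sum_sub_le_of_chaining {S A : Type*} [Fintype A] {Y : Type*} {χ : A → S → ℤ}
    {w g : A → ℝ} {ℓ : S → Y} {f : Y → ℝ} {c : ℝ} (hg : ∀ a, |g a| ≤ w a)
    (hf : ∀ s, f (ℓ s) = c + ∑ a, χ a s * g a) (E E' : Fin n → S) :
    |∑ j, (f (ℓ (E j)) - f (ℓ (E' j)))| ≤
      ∑ a, w a * |((queryCounts χ E a - queryCounts χ E' a : ℤ) : ℝ)| := by
  have h1 : ∑ j, (f (ℓ (E j)) - f (ℓ (E' j))) =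
      ∑ a, g a * ((queryCounts χ E a - queryCounts χ E' a : ℤ) : ℝ) := by
    simp_rw [hf, add_sub_add_left_eq_sub, ← Finset.sum_sub_distrib]
    rw [Finset.sum_comm]
    refine Finset.sum_congr rfl fun a _ => ?_
    simp only [queryCounts]
    push_cast
    rw [← Finset.sum_sub_distrib, Finset.mul_sum]
    exact Finset.sum_congr rfl fun j _ => by ring
  rw [h1]
  refine (Finset.abs_sum_le_sum_abs _ _).trans (Finset.sum_le_sum fun a _ => ?_)
  rw [abs_mul]
  exact mul_le_mul_of_nonneg_right (hg a) (abs_nonneg _)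

/-- The best-fit algorithm for data that are discretized by `φ : T → S` with error `α`, and whose
output is returned through representatives with error `β`. The spaces of diameter at most `α + β`
need no queries. -/
theorem exists_isAccurate_of_chaining (hmeas : ∀ i, Measurable (h i)) (hK : 0 < K) (hn : 0 < n)
    (hε : 0 < ε) {S : Type*} [Finite S] [Nonempty S] [MeasurableSpace S]
    [DiscreteMeasurableSpace S] {φ : T → S} (hφ : Measurable φ) (rep : S → T) {α β : ℝ}
    (hα : 0 ≤ α) (hβ : 0 ≤ β) (ℓ : ∀ i, S → X i) (L : Fin K → ℕ) (W : Fin K → ℝ) {M : ℝ}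
    (hM : 0 < M)
    (hX : ∀ i, Metric.ediam (Set.univ : Set (X i)) ≤ ENNReal.ofReal (α + β) ∨
      ((∀ x, dist (h i x) (ℓ i (φ x)) ≤ α) ∧ (∀ s, dist (ℓ i s) (h i (rep s)) ≤ β) ∧
        HasChaining (ℓ i) (L i) (W i) ∧ 2 * K * (L i + 1) / ε * W i ≤ M)) :
    ∃ 𝒜 : RandomizedAlgorithm n T, IsAccurate h ε 𝒜
      (ENNReal.ofReal (α + β) + ENNReal.ofReal (4 * M * (Real.log K + 2) / n)) := by
  have hK' : (0 : ℝ) < K := by exact_mod_cast hK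
  have hn' : (0 : ℝ) < n := by exact_mod_cast hn
  -- Sensitivity `2 * L i` at noise scale `b i` uses at most the share `ε / K` of the privacy budget.
  set b : Fin K → ℝ := fun i => 2 * K * (L i + 1) / ε with hbdef
  have hb : ∀ i, 0 < b i := fun i => by positivity
  have hdata : ∀ i, ∃ (A : Type) (_ : Fintype A) (χ : A → S → ℤ) (w : A → ℝ),
      (∀ a, 0 ≤ w a) ∧ b i * ∑ a, w a ≤ M ∧
      (∀ s s', ∑ a, |(χ a s : ℝ) - χ a s'| ≤ 2 * L i) ∧
      (Metric.ediam (Set.univ : Set (X i)) ≤ ENNReal.ofReal (α + β) ∨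
        ((∀ x, dist (h i x) (ℓ i (φ x)) ≤ α) ∧ (∀ s, dist (ℓ i s) (h i (rep s)) ≤ β) ∧
          ∀ f : X i → ℝ, LipschitzWith 1 f →
            ∃ (c : ℝ) (g : A → ℝ), (∀ a, |g a| ≤ w a) ∧
              ∀ s, f (ℓ i s) = c + ∑ a, χ a s * g a)) := by
    intro i
    rcases hX i with hi | ⟨h1, h2, ⟨A, hA, χ, w, hw0, hwW, hL, hf⟩, h4⟩
    · exact ⟨Empty, inferInstance, fun a => a.elim, fun a => a.elim, fun a => a.elim,
        by simpa using hM.le, by simp, Or.inl hi⟩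
    · exact ⟨A, hA, χ, w, hw0, (mul_le_mul_of_nonneg_left hwW (hb i).le).trans h4, hL,
        Or.inr ⟨h1, h2, hf⟩⟩
  choose A hA χ w hw hbw hL hcase using hdata
  let χ' : (Σ i, A i) → S → ℤ := fun a => χ a.1 a.2
  have hdp : ∀ s s', ∑ a : Σ i, A i, |(χ' a s : ℝ) - χ' a s'| / b a.1 ≤ ε := by
    intro s s'
    rw [Fintype.sum_sigma]
    calc _ ≤ ∑ _i : Fin K, ε / K := by
          refine Finset.sum_le_sum fun i _ => ?_
          change ∑ a, |(χ i a s : ℝ) - χ i a s'| / b i ≤ ε / K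
          rw [← Finset.sum_div, div_le_iff₀ (hb i)]
          refine (hL i s s').trans ?_
          have : ε / K * b i = 2 * L i + 2 := by rw [hbdef]; field_simp
          rw [this]
          linarith
      _ = ε := by simp; field_simp
  have hloss : ∀ (D : Fin n → T) (ω : (Σ i, A i) → ℤ),
      utilityLoss (lipschitzQueries h) (empiricalMeasure D)
        (empiricalMeasure (rep ∘ bestFit n χ' w (queryCounts χ' (φ ∘ D) + ω))) ≤
      ENNReal.ofReal (α + β) + ENNReal.ofReal (2 / n) * ENNReal.ofReal (blockNorm w ω) := by
    intro D ω
    have hbn : 0 ≤ blockNorm w ω := norm_nonneg _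
    have hfit := blockNorm_bestFit_sub_le χ' hw (φ ∘ D) ω
    set E := bestFit n χ' w (queryCounts χ' (φ ∘ D) + ω)
    refine utilityLoss_empiricalMeasure_le hmeas D _ fun i f hf => ?_
    rcases hcase i with hi | ⟨h1, h2, h3⟩
    · exact (ofReal_inv_mul_abs_sum_le_ediam hn (fun j => h i (D j))
        (fun j => h i ((rep ∘ E) j)) hf).trans (hi.trans le_self_add)
    · obtain ⟨c, g, hg, hs⟩ := h3 f hf
      have hlip : ∀ x y, |f x - f y| ≤ dist x y := fun x y => by
        simpa [Real.dist_eq] using hf.dist_le_mul x y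
      have e1 := inv_mul_abs_sum_le hn (u := fun j => f (h i (D j)) - f (ℓ i (φ (D j))))
        (fun j => (hlip _ _).trans (h1 (D j)))
      have e2 := inv_mul_abs_sum_le hn (u := fun j => f (ℓ i (E j)) - f (h i (rep (E j))))
        (fun j => (hlip _ _).trans (h2 (E j)))
      have e3 := abs_sum_sub_le_of_chaining hg hs (φ ∘ D) E
      have e4 := (sum_le_blockNorm w _ i).trans hfit
      have e5 : (n : ℝ)⁻¹ * |∑ j, (f (ℓ i ((φ ∘ D) j)) - f (ℓ i (E j)))| ≤
          2 / n * blockNorm w ω := by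
        rw [div_mul_eq_mul_div, div_eq_inv_mul]
        exact mul_le_mul_of_nonneg_left (e3.trans e4) (by positivity)
      rw [← ENNReal.ofReal_mul (by positivity), ← ENNReal.ofReal_add (by positivity)
        (by positivity)]
      apply ENNReal.ofReal_le_ofReal
      have hsplit : ∑ j, (f (h i (D j)) - f (h i ((rep ∘ E) j))) =
          ∑ j, (f (h i (D j)) - f (ℓ i (φ (D j)))) +
          ∑ j, (f (ℓ i ((φ ∘ D) j)) - f (ℓ i (E j))) +
          ∑ j, (f (ℓ i (E j)) - f (h i (rep (E j)))) := by
        rw [← Finset.sum_add_distrib, ← Finset.sum_add_distrib]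
        exact Finset.sum_congr rfl fun j _ => by simp
      rw [hsplit]
      calc _ ≤ (n : ℝ)⁻¹ * (|∑ j, (f (h i (D j)) - f (ℓ i (φ (D j))))| +
            |∑ j, (f (ℓ i ((φ ∘ D) j)) - f (ℓ i (E j)))| +
            |∑ j, (f (ℓ i (E j)) - f (h i (rep (E j))))|) :=
            mul_le_mul_of_nonneg_left (abs_add_three _ _ _) (by positivity)
        _ ≤ _ := by rw [mul_add, mul_add]; linarith
  have hprob := isProbabilityMeasure_laplaceNoise fun a : Σ i, A i => hb a.1
  refine ⟨bestFitAlgorithm hn hφ rep χ' w hb, bestFitAlgorithm_isDP hn hφ rep χ' w hb hdp,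
    fun D ω => finitelySupported_empiricalMeasure _, fun D D' hD => ?_, fun D => ⟨?_, ?_, ?_⟩⟩
  · have := queryCounts_comp_congr hn hφ χ' hD
    simp only [bestFitAlgorithm, this]
  · exact measurable_of_countable (α := (Σ i, A i) → ℤ) _
  · refine (lintegral_mono fun ω =>
      utilityLoss_empiricalMeasure_le_iSup_ediam hmeas hn D _).trans ?_
    rw [lintegral_const, measure_univ, mul_one]
  · refine (lintegral_mono fun ω => hloss D ω).trans ?_
    have hint : ∫⁻ ω, (ENNReal.ofReal (α + β) + ENNReal.ofReal (2 / n) *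
        ENNReal.ofReal (blockNorm w ω)) ∂laplaceNoise (fun a : Σ i, A i => b a.1) ≤
        ENNReal.ofReal (α + β) + ENNReal.ofReal (4 * M * (Real.log K + 2) / n) := by
      rw [lintegral_add_left measurable_const, lintegral_const, measure_univ, mul_one,
        lintegral_const_mul _ (measurable_of_countable _)]
      gcongr
      refine (mul_le_mul_right (lintegral_blockNorm_le hK hw hb hM hbw) _).trans ?_
      rw [← ENNReal.ofReal_mul (by positivity)]
      apply ENNReal.ofReal_le_ofReal
      apply le_of_eq
      ring
    exact hint

/-- For several spaces the data are discretized at scale `t` in each of them. The output must be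
pulled back to `T` through points that realize the same discretization in all of the spaces, which
costs another `t`. -/
theorem exists_isAccurate_of_covers [Nonempty T] (hmeas : ∀ i, Measurable (h i)) (hK : 0 < K)
    (hn : 0 < n) (hε : 0 < ε) {t : ℝ} (ht : 0 < t) {M : ℝ} (hM : 0 < M)
    (hX : ∀ i, Metric.ediam (Set.univ : Set (X i)) ≤ ENNReal.ofReal (t + t) ∨
      ∃ (m L : ℕ) (W : ℝ) (c : Fin m → X i), (∀ y, ∃ j, dist y (c j) ≤ t) ∧
        HasChaining c L W ∧ 2 * K * (L + 1) / ε * W ≤ M) :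
    ∃ 𝒜 : RandomizedAlgorithm n T, IsAccurate h ε 𝒜
      (ENNReal.ofReal (t + t) + ENNReal.ofReal (4 * M * (Real.log K + 2) / n)) := by
  obtain ⟨x₀⟩ := ‹Nonempty T›
  have hdata : ∀ i, ∃ (m L : ℕ) (W : ℝ) (c : Fin m → X i) (ψ : X i → Fin m), Measurable ψ ∧
      (Metric.ediam (Set.univ : Set (X i)) ≤ ENNReal.ofReal (t + t) ∨
        ((∀ y, dist y (c (ψ y)) ≤ t) ∧ HasChaining c L W ∧ 2 * K * (L + 1) / ε * W ≤ M)) := by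
    intro i
    rcases hX i with hi | ⟨m, L, W, c, hc, h1, h2⟩
    · exact ⟨1, 0, 0, fun _ => h i x₀, fun _ => 0, measurable_const, Or.inl hi⟩
    · obtain ⟨ψ, hψ, hψc⟩ := exists_measurable_index hc
      exact ⟨m, L, W, c, ψ, hψ, Or.inr ⟨hψc, h1, h2⟩⟩
  choose m L W c ψ hψ hcase using hdata
  -- Only the attained values of the joint discretization `Φ` have representatives.
  let Φ : T → ∀ i, Fin (m i) := fun x i => ψ i (h i x)
  have hΦ : Measurable Φ := measurable_pi_lambda _ fun i => (hψ i).comp (hmeas i)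
  have : Nonempty (Set.range Φ) := ⟨⟨Φ x₀, x₀, rfl⟩⟩
  refine exists_isAccurate_of_chaining hmeas hK hn hε (S := Set.range Φ)
    (φ := fun x => ⟨Φ x, x, rfl⟩) (hΦ.subtype_mk) (fun s => s.2.choose) ht.le ht.le
    (fun i s => c i (s.1 i)) L W hM fun i => (hcase i).imp_right fun ⟨h1, h2, h3⟩ =>
      ⟨fun x => h1 _, fun s => ?_, h2.comp fun s : Set.range Φ => s.1 i, h3⟩
  have hs : Φ s.2.choose i = s.1 i := congrFun s.2.choose_spec i
  rw [← hs, dist_comm]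
  exact h1 _

end Algorithms

/-- For a single space the output may be supported on the preimages of the centres of the cover, so
that only the data are displaced. -/
theorem exists_isAccurate_of_cover {T : Type*} [MeasurableSpace T] {n : ℕ} {X : Fin 1 → Type*}
    [∀ i, MetricSpace (X i)] [∀ i, MeasurableSpace (X i)] [∀ i, BorelSpace (X i)]
    {h : ∀ i, T → X i} [Nonempty T] (hmeas : ∀ i, Measurable (h i))
    (hsurj : ∀ i, Function.Surjective (h i)) (hn : 0 < n) {ε : ℝ} (hε : 0 < ε) {α : ℝ} (hα : 0 ≤ α)
    {m L : ℕ} {W M : ℝ} (hM : 0 < M) {c : Fin m → X 0} (hc : ∀ y, ∃ j, dist y (c j) ≤ α)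
    (hchain : HasChaining c L W) (hLM : 2 * (L + 1) / ε * W ≤ M) :
    ∃ 𝒜 : RandomizedAlgorithm n T, IsAccurate h ε 𝒜
      (ENNReal.ofReal α + ENNReal.ofReal (8 * M / n)) := by
  obtain ⟨x₀⟩ := ‹Nonempty T›
  obtain ⟨ψ, hψ, hψc⟩ := exists_measurable_index hc
  have : Nonempty (Fin m) := ⟨ψ (h 0 x₀)⟩
  choose rep hrep using fun j => hsurj 0 (c j)
  obtain ⟨𝒜, h𝒜⟩ := exists_isAccurate_of_chaining hmeas one_pos hn hε (hψ.comp (hmeas 0)) rep hα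
    le_rfl (fun i s => h i (rep s)) (fun _ => L) (fun _ => W) hM fun i => by
      obtain rfl := Subsingleton.elim 0 i
      simp only [hrep, dist_self]
      exact Or.inr ⟨fun x => hψc _, fun _ => le_rfl, hchain, by simpa using hLM⟩
  refine ⟨𝒜, h𝒜.mono (le_of_eq ?_)⟩
  rw [add_zero, Nat.cast_one, Real.log_one]
  congr 2
  ring

/-! ### The two accuracy bounds -/

section Complexity

variable {K : ℕ} {X : Fin K → Type*} [∀ i, MetricSpace (X i)] {t : ℝ}

theorem coveringIntegral_le_stackedComplexity (i : Fin K) :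
    coveringIntegral (X i) t ≤ stackedComplexity X t := by
  refine le_trans ?_ (le_iSup (fun i => (ceilLogTwo (covNum (X i) t) + 1 +
    ENNReal.ofReal (Real.log K)) ^ 2 * coveringIntegral (X i) t) i)
  refine le_mul_of_one_le_left' (one_le_pow₀ ?_)
  rw [add_assoc, add_left_comm]
  exact le_self_add

/-- When the complexity is finite, so are the diameters and the covering numbers at scale `t` of the
spaces of diameter above `t`. -/
theorem exists_diam_covNum_of_stackedComplexity [∀ i, Nonempty (X i)] (ht : 0 < t) {lam : ℝ}
    (hlam0 : 0 ≤ lam) (hlam : stackedComplexity X t = ENNReal.ofReal lam) (i : Fin K) :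
    ∃ d J : ℝ, 0 ≤ J ∧ J ≤ lam ∧ Metric.ediam (Set.univ : Set (X i)) = ENNReal.ofReal d ∧
      coveringIntegral (X i) t = ENNReal.ofReal J ∧
      (t < d → ∃ N : ℕ, covNum (X i) t = N ∧ (Nat.clog 2 N + 1 + Real.log K) ^ 2 * J ≤ lam) := by
  have hJle : coveringIntegral (X i) t ≤ ENNReal.ofReal lam :=
    hlam ▸ coveringIntegral_le_stackedComplexity i
  have hJtop : coveringIntegral (X i) t ≠ ⊤ := ne_top_of_le_ne_top ENNReal.ofReal_ne_top hJle
  have hdtop : Metric.ediam (Set.univ : Set (X i)) ≠ ⊤ :=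
    ne_top_of_le_ne_top (ENNReal.add_ne_top.2 ⟨ENNReal.ofReal_ne_top,
      ENNReal.mul_ne_top ENNReal.ofNat_ne_top hJtop⟩) (ediam_le_add_coveringIntegral ht)
  have hJ := (ENNReal.ofReal_toReal hJtop).symm
  have hd := (ENNReal.ofReal_toReal hdtop).symm
  set J := (coveringIntegral (X i) t).toReal with hJdef
  set d := (Metric.ediam (Set.univ : Set (X i))).toReal
  refine ⟨d, J, ENNReal.toReal_nonneg, ?_, hd, hJ, fun htd => ?_⟩
  · rwa [hJ, ENNReal.ofReal_le_ofReal_iff hlam0] at hJle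
  have hterm : (ceilLogTwo (covNum (X i) t) + 1 + ENNReal.ofReal (Real.log K)) ^ 2 *
      coveringIntegral (X i) t ≤ ENNReal.ofReal lam :=
    hlam ▸ le_iSup (fun i => (ceilLogTwo (covNum (X i) t) + 1 +
      ENNReal.ofReal (Real.log K)) ^ 2 * coveringIntegral (X i) t) i
  have hJpos : coveringIntegral (X i) t ≠ 0 := by
    have h1 := covNum_mul_le_coveringIntegral hd ht
    have h2 : (0 : ℝ≥0∞) < (covNum (X i) (d / 2) : ℝ≥0∞) * ENNReal.ofReal ((d - t) / 2) := by
      refine ENNReal.mul_pos ?_ ?_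
      · have := one_le_covNum (X := X i) (d / 2)
        intro h0
        rw [ENat.toENNReal_eq_zero] at h0
        rw [h0] at this
        simp at this
      · simp only [ne_eq, ENNReal.ofReal_eq_zero, not_le]; linarith
    exact (h2.trans_le h1).ne'
  have hNtop : covNum (X i) t ≠ ⊤ := by
    intro hN
    rw [hN] at hterm
    have h0 : ceilLogTwo ⊤ = ⊤ := rfl
    rw [h0, top_add, top_add, ENNReal.top_pow two_ne_zero, ENNReal.top_mul hJpos] at hterm
    exact ENNReal.ofReal_ne_top (top_le_iff.1 hterm)
  obtain ⟨N, hN⟩ := ENat.ne_top_iff_exists.1 hNtop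
  refine ⟨N, hN.symm, ?_⟩
  have h0 : ceilLogTwo (N : ℕ∞) = ENNReal.ofReal (Nat.clog 2 N) := by
    rw [ENNReal.ofReal_natCast]; rfl
  have hlog : 0 ≤ Real.log K := Real.log_natCast_nonneg K
  rw [← hN, h0, hJ, ← ENNReal.ofReal_one, ← ENNReal.ofReal_add (by positivity) zero_le_one,
    ← ENNReal.ofReal_add (by positivity) hlog, ← ENNReal.ofReal_pow (by positivity),
    ← ENNReal.ofReal_mul (by positivity), ENNReal.ofReal_le_ofReal_iff hlam0] at hterm
  exact hterm

/-- The weight of the chaining down to scale `t` fits the noise level `256 K λ / (ε (log K + 2))`. -/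
theorem noise_scale_mul_weight_le {K ε l a J lam : ℝ} (hK : 0 ≤ K) (hε : 0 < ε) (hl : 0 ≤ l)
    (ha : 0 ≤ a) (hJ : 0 ≤ J) (h : (a + 1 + l) ^ 2 * J ≤ lam) :
    2 * K * (a + 1) / ε * (64 * J) ≤ 256 * K * lam / (ε * (l + 2)) := by
  have h1 : (a + 1) * (l + 2) * J ≤ 2 * lam := by
    have : (a + 1) * (l + 2) ≤ 2 * (a + 1 + l) ^ 2 := by nlinarith [mul_nonneg ha hl]
    nlinarith [mul_le_mul_of_nonneg_right this hJ]
  rw [div_mul_eq_mul_div, div_le_div_iff₀ hε (by positivity)]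
  have h2 := mul_le_mul_of_nonneg_left h1 (show 0 ≤ 128 * K * ε by positivity)
  nlinarith

end Complexity

/-- The second accuracy bound, for a finite and nonzero complexity `lam`. -/
theorem exists_isAccurate {T : Type*} [MeasurableSpace T] {K n : ℕ} {X : Fin K → Type*}
    [∀ i, MetricSpace (X i)] [∀ i, MeasurableSpace (X i)] [∀ i, BorelSpace (X i)]
    {h : ∀ i, T → X i} [Nonempty T] (hK : 0 < K) (hmeas : ∀ i, Measurable (h i))
    (hsurj : ∀ i, Function.Surjective (h i)) (hn : 0 < n) {ε : ℝ} (hε : 0 < ε) {t : ℝ} (ht : 0 < t)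
    {lam : ℝ} (hlam0 : 0 < lam) (hlam : stackedComplexity X t = ENNReal.ofReal lam) :
    ∃ 𝒜 : RandomizedAlgorithm n T, IsAccurate h ε 𝒜
      (ENNReal.ofReal (if K = 1 then t else 2 * t) + ENNReal.ofReal (1024 * K / (n * ε) * lam)) := by
  have hne : ∀ i, Nonempty (X i) := fun i => ‹Nonempty T›.map (h i)
  have hK' : (0 : ℝ) < K := by exact_mod_cast hK
  have hn' : (0 : ℝ) < n := by exact_mod_cast hn
  have hlog : 0 ≤ Real.log K := Real.log_natCast_nonneg K
  have hdata := exists_diam_covNum_of_stackedComplexity (X := X) ht hlam0.le hlam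
  by_cases hK1 : K = 1
  · subst hK1
    rw [if_pos rfl]
    obtain ⟨d, J, hJ0, hJlam, hd, hJ, hN⟩ := hdata 0
    have hsup : ⨆ i, Metric.ediam (Set.univ : Set (X i)) = ENNReal.ofReal d := by
      rw [ciSup_unique]; exact hd
    obtain ⟨𝒜₀, h𝒜₀⟩ := exists_isAccurate_iSup_ediam hmeas hn hε
    rw [hsup] at h𝒜₀
    rcases le_or_gt d t with hdt | hdt
    · exact ⟨𝒜₀, h𝒜₀.mono ((ENNReal.ofReal_le_ofReal hdt).trans le_self_add)⟩
    rcases le_or_gt (4 * t / 3) d with hd4 | hd4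
    · obtain ⟨N, hNt, hNlam⟩ := hN hdt
      obtain ⟨c, hc, hchain⟩ := exists_chaining hd ht hd4 hNt hJ0 hJ
      have hw := noise_scale_mul_weight_le zero_le_one hε le_rfl (Nat.cast_nonneg _) hJ0
        (by simpa using hNlam)
      obtain ⟨𝒜, h𝒜⟩ := exists_isAccurate_of_cover hmeas hsurj hn hε ht.le
        (M := 256 * 1 * lam / (ε * (0 + 2))) (by positivity) hc hchain (by simpa using hw)
      refine ⟨𝒜, h𝒜.mono (le_of_eq ?_)⟩
      congr 2
      push_cast
      field_simp
      norm_num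
    · -- The diameter barely exceeds `t`: a single scale `d / 2` suffices, unless the noise is so
      -- large that a constant answer, off by `d = t + (d - t)`, is good enough.
      have hint := covNum_mul_le_coveringIntegral hd ht
      rw [hJ] at hint
      have hfin : covNum (X 0) (d / 2) ≠ ⊤ := by
        intro htop
        rw [htop, ENat.toENNReal_top, ENNReal.top_mul (by
          simp only [ne_eq, ENNReal.ofReal_eq_zero, not_le]; linarith)] at hint
        exact ENNReal.ofReal_ne_top (top_le_iff.1 hint)
      obtain ⟨m, hm⟩ := ENat.ne_top_iff_exists.1 hfin
      have hm1 : (1 : ℝ) ≤ m := by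
        have := one_le_covNum (X := X 0) (d / 2)
        rw [← hm] at this
        exact_mod_cast this
      rw [← hm, ENat.toENNReal_coe, ← ENNReal.ofReal_natCast,
        ← ENNReal.ofReal_mul (by positivity), ENNReal.ofReal_le_ofReal_iff hJ0] at hint
      rcases le_or_gt (n * ε) (128 * m) with hnm | hnm
      · refine ⟨𝒜₀, h𝒜₀.mono ?_⟩
        rw [← ENNReal.ofReal_add ht.le (by positivity)]
        apply ENNReal.ofReal_le_ofReal
        have h1 : d - t ≤ 1024 * ((1 : ℕ) : ℝ) / (n * ε) * lam := by
          rw [div_mul_eq_mul_div, le_div_iff₀ (by positivity)]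
          have := mul_le_mul_of_nonneg_left hnm (show 0 ≤ d - t by linarith)
          push_cast
          nlinarith
        linarith
      · obtain ⟨c, hc⟩ := exists_cover_of_covNum_le (X := X 0) (by linarith : 0 ≤ d / 2) hm.ge
        have hdist : ∀ j j', dist (c j) (c j') ≤ d := fun j j' => by
          have := Metric.edist_le_ediam_of_mem (Set.mem_univ (c j)) (Set.mem_univ (c j'))
          rwa [hd, edist_dist, ENNReal.ofReal_le_ofReal_iff (by linarith)] at this
        have : Nonempty (Fin m) := ⟨⟨0, by exact_mod_cast (zero_lt_one.trans_le hm1)⟩⟩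
        obtain ⟨𝒜, h𝒜⟩ := exists_isAccurate_of_cover hmeas hsurj hn hε
          (by linarith : 0 ≤ d / 2) (M := 4 * m * d / ε)
          (div_pos (mul_pos (by linarith) (by linarith)) hε) hc (HasChaining.of_dist_le c hdist)
          (le_of_eq (by rw [Fintype.card_fin]; push_cast; ring))
        refine ⟨𝒜, h𝒜.mono (le_trans ?_ le_self_add)⟩
        have hd0 : 0 < d := by linarith
        rw [← ENNReal.ofReal_add (by linarith) (by positivity)]
        apply ENNReal.ofReal_le_ofReal
        have : 8 * (4 * m * d / ε) / n ≤ d / 4 := by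
          rw [← mul_div_assoc, div_div, div_le_div_iff₀ (by positivity) (by norm_num)]
          nlinarith
        linarith
  · rw [if_neg hK1]
    obtain ⟨𝒜, h𝒜⟩ := exists_isAccurate_of_covers hmeas hK hn hε ht
      (M := 256 * K * lam / (ε * (Real.log K + 2))) (by positivity) fun i => by
        obtain ⟨d, J, hJ0, hJlam, hd, hJ, hN⟩ := hdata i
        rcases le_or_gt d (t + t) with hdt | hdt
        · exact Or.inl (hd.trans_le (ENNReal.ofReal_le_ofReal hdt))
        · obtain ⟨N, hNt, hNlam⟩ := hN (by linarith)
          obtain ⟨c, hc, hchain⟩ := exists_chaining hd ht (by linarith) hNt hJ0 hJ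
          exact Or.inr ⟨_, _, _, c, hc, hchain,
            noise_scale_mul_weight_le hK'.le hε hlog (Nat.cast_nonneg _) hJ0 hNlam⟩
    refine ⟨𝒜, h𝒜.mono (le_of_eq ?_)⟩
    rw [two_mul]
    congr 2
    field_simp
    norm_num

theorem mainTheorem1 :
    ∃ c : ℝ, 0 < c ∧
      ∀ {T : Type*} [MeasurableSpace T] {K : ℕ} (_hK : 0 < K)
        {X : Fin K → Type*} [∀ i, MetricSpace (X i)] [∀ i, MeasurableSpace (X i)]
        [∀ i, BorelSpace (X i)] (h : ∀ i, T → X i)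
        (_hmeas : ∀ i, Measurable (h i)) (_hsurj : ∀ i, Function.Surjective (h i))
        (n : ℕ) (_hn : 0 < n) (ε : ℝ) (_hε : 0 < ε) (t : ℝ) (_ht : 0 < t),
        ∃ A : RandomizedAlgorithm n T,
          A.IsDP ε ∧
          (∀ D ω, FinitelySupported (A.run D ω : Measure T)) ∧
          (∀ D D', empiricalMeasure D = empiricalMeasure D' → A.run D = A.run D') ∧
          ∀ D : Fin n → T,
            Measurable (fun ω =>
              utilityLoss (lipschitzQueries h) (empiricalMeasure D) (A.run D ω)) ∧
            ∫⁻ ω, utilityLoss (lipschitzQueries h) (empiricalMeasure D) (A.run D ω) ∂A.P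
              ≤ ENNReal.ofReal t + ENNReal.ofReal (c * K) * stackedComplexity X t ∧
            ∫⁻ ω, utilityLoss (lipschitzQueries h) (empiricalMeasure D) (A.run D ω) ∂A.P
              ≤ ENNReal.ofReal (if K = 1 then t else 2 * t) +
                ENNReal.ofReal (c * K / (n * ε)) * stackedComplexity X t := by
  refine ⟨1024, by norm_num, ?_⟩
  intro T _ K hK X _ _ _ h hmeas hsurj n hn ε hε t ht
  have hK' : (0 : ℝ) < K := by exact_mod_cast hK
  have hn' : (0 : ℝ) < n := by exact_mod_cast hn
  have hK1 : (1 : ℝ) ≤ K := by exact_mod_cast hK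
  have hfac : 0 < 1024 * (K : ℝ) / (n * ε) := by positivity
  obtain ⟨𝒜₀, h𝒜₀⟩ := exists_isAccurate_iSup_ediam hmeas hn hε
  rcases isEmpty_or_nonempty T with hT | hT
  · exact ⟨𝒜₀, h𝒜₀.1, h𝒜₀.2.1, h𝒜₀.2.2.1, fun D => hT.elim (D ⟨0, hn⟩)⟩
  have hne : ∀ i, Nonempty (X i) := fun i => hT.map (h i)
  have hdiam : ⨆ i, Metric.ediam (Set.univ : Set (X i)) ≤
      ENNReal.ofReal t + 2 * stackedComplexity X t :=
    iSup_le fun i => (ediam_le_add_coveringIntegral ht).trans <| by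
      gcongr; exact coveringIntegral_le_stackedComplexity i
  suffices hex : ∃ 𝒜 : RandomizedAlgorithm n T, IsAccurate h ε 𝒜
      (ENNReal.ofReal (if K = 1 then t else 2 * t) +
        ENNReal.ofReal (1024 * K / (n * ε)) * stackedComplexity X t) by
    obtain ⟨𝒜, h1, h2, h3, h4⟩ := hex
    refine ⟨𝒜, h1, h2, h3, fun D => ⟨(h4 D).1, ((h4 D).2.1.trans hdiam).trans ?_, (h4 D).2.2⟩⟩
    gcongr
    rw [show (2 : ℝ≥0∞) = ENNReal.ofReal 2 by simp]
    exact ENNReal.ofReal_le_ofReal (by linarith)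
  rcases eq_or_ne (stackedComplexity X t) ⊤ with htop | htop
  · refine ⟨𝒜₀, h𝒜₀.mono ?_⟩
    rw [htop, ENNReal.mul_top (by simpa using hfac), add_top]
    exact le_top
  rcases eq_or_ne (stackedComplexity X t) 0 with hzero | hzero
  · refine ⟨𝒜₀, h𝒜₀.mono ?_⟩
    rw [hzero, mul_zero, add_zero] at hdiam ⊢
    refine hdiam.trans (ENNReal.ofReal_le_ofReal ?_)
    split_ifs <;> linarith
  · have hlam := (ENNReal.ofReal_toReal htop).symm
    obtain ⟨𝒜, h𝒜⟩ := exists_isAccurate hK hmeas hsurj hn hε ht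
      (ENNReal.toReal_pos hzero htop) hlam
    refine ⟨𝒜, h𝒜.mono (le_of_eq ?_)⟩
    rw [ENNReal.ofReal_mul hfac.le, ← hlam]
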